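/- **Model.** An energy RAM with word size $w$ has finitely many registers of $w$ bits, a bit-addressed memory in which any contiguous segment of at most $w$ bits is accessed by one instruction, and cells that are empty or hold a $d$-bit key. Keys may only be compared, copied into empty cells, removed as known copies of another cell, moved, or overwritten. A program is a fixed finite text, independent of the number $n$ of keys, of $d$ and of $w$. Every instruction and every test takes one unit of time. The energy of a run is the number of bits that it discards: reversible instructions (in-place addition and subtraction of the value of a word operation on other registers, exchange, comparison into a register, copying into empty space, and their inverses) and branches and loops whose joins are paired with a test telling where control came from cost $0$; overwriting costs the number of bits overwritten, and in-place bitwise And/Or and every pass through an unpaired join of the control flow cost $1$. The auxiliary space of a run is measured in bits: $w$ for each register of the program, the length of the initial part of the bit memory that is accessed, and $d$ for every key cell beyond the input up to the last one accessed (so the output is included). **Theorem.** There are a program $P$, an integer $a\ge 0$ and constants $c_1,c_2,c_3>0$, and for every integer $K\ge 0$ a constant $c_4>0$, such that the following holds for all $n\ge 2$, $d\ge 1$ and $w$ with $d\le w\le K\,nd$ and $a\,nd<2^w$ (a word holds a key, is not larger than a constant multiple of the input, and can address a constant multiple of the $nd$ bits of the input); in particular $d=o(\lg n)$ is allowed.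 Let $L$ be any array of $n$ $d$-bit keys. Started with $L$ in the first $n$ key cells, with $n$ and $d$ in two registers and with everything else empty, $P$ halts in the state that differs from the initial one only in that the next $n$ key cells hold $L$ sorted in nondecreasing order (so $L$ itself is kept and all working storage is empty again). The run takes time between $c_1\,n\lg n$ and $c_2\,n\lg n$, uses auxiliary space between $c_3\,nd$ and $c_4\,nd$ bits, and consumes energy $0$. In short: comparison sort, not destroying its input, can be done reversibly on $n$ $d$-bit elements in $\Theta(n\lg n)$ time, $\Theta(nd)$ bits of auxiliary space, and $0$ energy. -/

import Mathlib

/-!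
# An energy RAM for comparison sorting

The machine has word size `w` and works on `d`-bit keys.  Its storage consists of

* finitely many registers (those that the program mentions), each holding a `w`-bit word;
* a bit-addressed memory, initially `0`, in which any contiguous segment of at most `w` bits can be
  accessed by one instruction;
* cells for keys.  A cell is empty or holds a `d`-bit key.  As in every comparison sort, keys can
  be compared, copied, and moved, but not inspected in any other way.

Programs are fixed finite texts that do not depend on the number of keys, on `d`, or on `w`.
Every instruction and every evaluation of a test takes one unit of time.  Energy is the number of
bits that are discarded: the reversible instructions (which are injective and come with their
inverse) and the paired two-way branches cost nothing, while overwriting, bitwise conjunction and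
disjunction in place, and unpaired joins of the control flow are available, but cost energy.

Instructions are partial.  Whatever they promise (an empty target of a copy, no overflow, ...) has
to hold when they are executed, otherwise the program has no run.
-/

namespace EnergyRAM

/-- Binary word operations. -/
inductive BinOp
  | left | add | sub | mul | div | mod | land | lor | lxor | shl | shr | eq | le | lt

/-- Value of a binary word operation; comparisons return `1` for true and `0` for false, and
subtraction is truncated at `0`. -/
def BinOp.eval : BinOp → ℕ → ℕ → ℕ
  | left, y, _ => y
  | add, y, z => y + z
  | sub, y, z => y - z
  | mul, y, z => y * z
  | div, y, z => y / z
  | mod, y, z => y % z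
  | land, y, z => y &&& z
  | lor, y, z => y ||| z
  | lxor, y, z => y ^^^ z
  | shl, y, z => y <<< z
  | shr, y, z => y >>> z
  | eq, y, z => if y = z then 1 else 0
  | le, y, z => if y ≤ z then 1 else 0
  | lt, y, z => if y < z then 1 else 0

/-- Instructions.  All arguments are names of registers, except for the literal constant `k` in
`addC` and `subC`. -/
inductive Instr
  /-- `x += k` -/
  | addC (x k : ℕ)
  /-- `x -= k` -/
  | subC (x k : ℕ)
  /-- `x += y op z` -/
  | add (x : ℕ) (op : BinOp) (y z : ℕ)
  /-- `x -= y op z` -/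
  | sub (x : ℕ) (op : BinOp) (y z : ℕ)
  /-- negate `x`, which has to be `0` or `1` -/
  | not (x : ℕ)
  /-- exchange two registers -/
  | swap (x y : ℕ)
  /-- `x += mem[p, p + l)` -/
  | load (x p l : ℕ)
  /-- `x -= mem[p, p + l)` -/
  | unload (x p l : ℕ)
  /-- `mem[p, p + l) += x` -/
  | store (x p l : ℕ)
  /-- `mem[p, p + l) -= x` -/
  | unstore (x p l : ℕ)
  /-- `x += (key[a] ≤ key[b])` -/
  | keyLe (x a b : ℕ)
  /-- `x -= (key[a] ≤ key[b])` -/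
  | keyUnLe (x a b : ℕ)
  /-- copy `key[a]` into the empty cell `b` -/
  | keyCopy (a b : ℕ)
  /-- empty the cell `b`, which has to hold a copy of `key[a]` -/
  | keyUnCopy (a b : ℕ)
  /-- exchange the contents of two cells -/
  | keySwap (a b : ℕ)
  /-- irreversible: `x := y` -/
  | set (x y : ℕ)
  /-- irreversible: `x := x ∧ y` bitwise -/
  | andSet (x y : ℕ)
  /-- irreversible: `x := x ∨ y` bitwise -/
  | orSet (x y : ℕ)
  /-- irreversible: `mem[p, p + l) := x` -/
  | memSet (x p l : ℕ)
  /-- irreversible: overwrite the cell `b` with `key[a]` -/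
  | keySet (a b : ℕ)

/-- Tests, evaluated on registers. -/
inductive Test
  | eqC (x k : ℕ)
  | eq (x y : ℕ)
  | le (x y : ℕ)
  | lt (x y : ℕ)
  | not (t : Test)
  | and (t u : Test)

/-- Structured programs. -/
inductive Prog
  | skip
  | instr (i : Instr)
  | seq (P Q : Prog)
  /-- Two-way branch: if `t` holds, execute `P`, otherwise `Q`.  At the join the paired test `u`
  tells where the control came from: it has to hold after `P` and to fail after `Q`. -/
  | branch (t : Test) (P Q : Prog) (u : Test)
  /-- Two-way loop: execute `P`; leave the loop if `u` holds; otherwise execute `Q` and repeat.  At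
  the head of the loop the paired test `t` tells where the control came from: it has to hold when
  the loop is entered and to fail whenever control comes back. -/
  | loop (t : Test) (P Q : Prog) (u : Test)
  /-- Conditional with an unpaired join (irreversible). -/
  | ite (t : Test) (P Q : Prog)
  /-- While loop with an unpaired join at its head (irreversible). -/
  | while (t : Test) (P : Prog)

/-- Machine states.  `key i = none` means that the cell `i` is empty. -/
@[ext]
structure State (d : ℕ) where
  reg : ℕ → ℕ
  mem : ℕ → Bool
  key : ℕ → Option (Fin (2 ^ d))

/-- Resources used by a run: number of steps, number of discarded bits, and the least upper bounds
(exclusive) for the addresses of the bits and of the key cells that were accessed. -/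
@[ext]
structure Cost where
  time : ℕ
  energy : ℕ
  bits : ℕ
  keys : ℕ

/-- Resources of two runs one after the other. -/
def Cost.seq (c c' : Cost) : Cost :=
  ⟨c.time + c'.time, c.energy + c'.energy, max c.bits c'.bits, max c.keys c'.keys⟩

/-- One evaluation of a test that discards `e` bits. -/
def Cost.test (e : ℕ) : Cost := ⟨1, e, 0, 0⟩

/-- One instruction on registers that discards `e` bits. -/
def Cost.onReg (e : ℕ) : Cost := ⟨1, e, 0, 0⟩

/-- One access to `mem[p, p + l)` that discards `e` bits. -/
def Cost.onMem (e p l : ℕ) : Cost := ⟨1, e, p + l, 0⟩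

/-- One access to the key cells `a` and `b` that discards `e` bits. -/
def Cost.onKey (e a b : ℕ) : Cost := ⟨1, e, 0, max a b + 1⟩

/-- Number represented in binary by the segment `mem[p, p + l)`. -/
def field (mem : ℕ → Bool) (p l : ℕ) : ℕ :=
  ∑ i ∈ Finset.range l, (mem (p + i)).toNat * 2 ^ i

/-- Write the number `v` in binary to the segment `mem[p, p + l)`. -/
def writeField (mem : ℕ → Bool) (p l v : ℕ) : ℕ → Bool :=
  fun j => if p ≤ j ∧ j < p + l then v.testBit (j - p) else mem j

/-- `1` if both cells hold keys and the first is at most the second one, otherwise `0`. -/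
def keyLeVal {d : ℕ} (x y : Option (Fin (2 ^ d))) : ℕ :=
  match x, y with
  | some u, some v => if u ≤ v then 1 else 0
  | _, _ => 0

namespace State

variable {d : ℕ}

def setReg (s : State d) (x v : ℕ) : State d :=
  { s with reg := Function.update s.reg x v }

def setField (s : State d) (p l v : ℕ) : State d :=
  { s with mem := writeField s.mem p l v }

def setKey (s : State d) (a : ℕ) (v : Option (Fin (2 ^ d))) : State d :=
  { s with key := Function.update s.key a v }

/-- The state in which the registers `0` and `1` hold `n` and `d`, the keys of the list `l` stand
in the first cells, and everything else is empty. -/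
def ofKeys (n d : ℕ) (l : List (Fin (2 ^ d))) : State d where
  reg := fun x => if x = 0 then n else if x = 1 then d else 0
  mem := fun _ => false
  key := fun i => l[i]?

end State

/-- Execution of one instruction with word size `w`; `none` if the instruction is undefined in the
given state. -/
def Instr.exec {d : ℕ} (w : ℕ) (i : Instr) (s : State d) : Option (State d × Cost) :=
  match i with
  | addC x k =>
      if s.reg x + k < 2 ^ w then some (s.setReg x (s.reg x + k), Cost.onReg 0) else none
  | subC x k =>
      if k ≤ s.reg x then some (s.setReg x (s.reg x - k), Cost.onReg 0) else none
  | add x op y z =>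
      let v := op.eval (s.reg y) (s.reg z)
      if x ≠ y ∧ x ≠ z ∧ s.reg x + v < 2 ^ w then
        some (s.setReg x (s.reg x + v), Cost.onReg 0) else none
  | sub x op y z =>
      let v := op.eval (s.reg y) (s.reg z)
      if x ≠ y ∧ x ≠ z ∧ v ≤ s.reg x then
        some (s.setReg x (s.reg x - v), Cost.onReg 0) else none
  | not x =>
      if s.reg x ≤ 1 then some (s.setReg x (1 - s.reg x), Cost.onReg 0) else none
  | swap x y =>
      some ((s.setReg x (s.reg y)).setReg y (s.reg x), Cost.onReg 0)
  | load x p l =>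
      let v := field s.mem (s.reg p) (s.reg l)
      if x ≠ p ∧ x ≠ l ∧ s.reg l ≤ w ∧ s.reg x + v < 2 ^ w then
        some (s.setReg x (s.reg x + v), Cost.onMem 0 (s.reg p) (s.reg l)) else none
  | unload x p l =>
      let v := field s.mem (s.reg p) (s.reg l)
      if x ≠ p ∧ x ≠ l ∧ s.reg l ≤ w ∧ v ≤ s.reg x then
        some (s.setReg x (s.reg x - v), Cost.onMem 0 (s.reg p) (s.reg l)) else none
  | store x p l =>
      let v := field s.mem (s.reg p) (s.reg l)
      if s.reg l ≤ w ∧ v + s.reg x < 2 ^ s.reg l then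
        some (s.setField (s.reg p) (s.reg l) (v + s.reg x), Cost.onMem 0 (s.reg p) (s.reg l))
      else none
  | unstore x p l =>
      let v := field s.mem (s.reg p) (s.reg l)
      if s.reg l ≤ w ∧ s.reg x ≤ v then
        some (s.setField (s.reg p) (s.reg l) (v - s.reg x), Cost.onMem 0 (s.reg p) (s.reg l))
      else none
  | keyLe x a b =>
      let v := keyLeVal (s.key (s.reg a)) (s.key (s.reg b))
      if x ≠ a ∧ x ≠ b ∧ (s.key (s.reg a)).isSome ∧ (s.key (s.reg b)).isSome ∧
          s.reg x + v < 2 ^ w then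
        some (s.setReg x (s.reg x + v), Cost.onKey 0 (s.reg a) (s.reg b)) else none
  | keyUnLe x a b =>
      let v := keyLeVal (s.key (s.reg a)) (s.key (s.reg b))
      if x ≠ a ∧ x ≠ b ∧ (s.key (s.reg a)).isSome ∧ (s.key (s.reg b)).isSome ∧
          v ≤ s.reg x then
        some (s.setReg x (s.reg x - v), Cost.onKey 0 (s.reg a) (s.reg b)) else none
  | keyCopy a b =>
      if (s.key (s.reg a)).isSome ∧ s.key (s.reg b) = none then
        some (s.setKey (s.reg b) (s.key (s.reg a)), Cost.onKey 0 (s.reg a) (s.reg b)) else none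
  | keyUnCopy a b =>
      if s.reg a ≠ s.reg b ∧ (s.key (s.reg a)).isSome ∧ s.key (s.reg b) = s.key (s.reg a) then
        some (s.setKey (s.reg b) none, Cost.onKey 0 (s.reg a) (s.reg b)) else none
  | keySwap a b =>
      some ((s.setKey (s.reg a) (s.key (s.reg b))).setKey (s.reg b) (s.key (s.reg a)),
        Cost.onKey 0 (s.reg a) (s.reg b))
  | set x y => some (s.setReg x (s.reg y), Cost.onReg w)
  | andSet x y => some (s.setReg x (s.reg x &&& s.reg y), Cost.onReg 1)
  | orSet x y => some (s.setReg x (s.reg x ||| s.reg y), Cost.onReg 1)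
  | memSet x p l =>
      if s.reg l ≤ w ∧ s.reg x < 2 ^ s.reg l then
        some (s.setField (s.reg p) (s.reg l) (s.reg x),
          Cost.onMem (s.reg l) (s.reg p) (s.reg l))
      else none
  | keySet a b =>
      some (s.setKey (s.reg b) (s.key (s.reg a)), Cost.onKey d (s.reg a) (s.reg b))

/-- Truth value of a test. -/
def Test.holds {d : ℕ} (s : State d) : Test → Prop
  | eqC x k => s.reg x = k
  | eq x y => s.reg x = s.reg y
  | le x y => s.reg x ≤ s.reg y
  | lt x y => s.reg x < s.reg y
  | not t => ¬ t.holds s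
  | and t u => t.holds s ∧ u.holds s

/-- The part of a two-way loop after its head, where `P` and `Q` are the meanings of the two parts
of the body. -/
inductive LoopRun {d : ℕ} (t : Test) (P Q : State d → State d → Cost → Prop) (u : Test) :
    State d → State d → Cost → Prop
  | exit {s s' : State d} {c : Cost} :
      P s s' c → u.holds s' → LoopRun t P Q u s s' (c.seq (Cost.test 0))
  | again {s s₁ s₂ s' : State d} {c₁ c₂ c : Cost} :
      P s s₁ c₁ → ¬ u.holds s₁ → Q s₁ s₂ c₂ → ¬ t.holds s₂ → LoopRun t P Q u s₂ s' c →
      LoopRun t P Q u s s'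
        (c₁.seq ((Cost.test 0).seq (c₂.seq ((Cost.test 0).seq c))))

/-- A while loop whose body has the meaning `P`.  Each arrival at its head discards one bit. -/
inductive WhileRun {d : ℕ} (t : Test) (P : State d → State d → Cost → Prop) :
    State d → State d → Cost → Prop
  | exit {s : State d} : ¬ t.holds s → WhileRun t P s s (Cost.test 1)
  | again {s s₁ s' : State d} {c₁ c : Cost} :
      t.holds s → P s s₁ c₁ → WhileRun t P s₁ s' c →
      WhileRun t P s s' ((Cost.test 1).seq (c₁.seq c))

/-- `P.Run w s s' c`: with word size `w`, the program `P` started in the state `s` halts in the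
state `s'` and uses the resources `c`. -/
def Prog.Run {d : ℕ} (w : ℕ) : Prog → State d → State d → Cost → Prop
  | skip, s, s', c => s' = s ∧ c = ⟨0, 0, 0, 0⟩
  | instr i, s, s', c => i.exec w s = some (s', c)
  | seq P Q, s, s', c => ∃ s₁ c₁ c₂, P.Run w s s₁ c₁ ∧ Q.Run w s₁ s' c₂ ∧ c = c₁.seq c₂
  | branch t P Q u, s, s', c =>
      (t.holds s ∧ u.holds s' ∧
        ∃ c₁, P.Run w s s' c₁ ∧ c = (Cost.test 0).seq (c₁.seq (Cost.test 0))) ∨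
      (¬ t.holds s ∧ ¬ u.holds s' ∧
        ∃ c₁, Q.Run w s s' c₁ ∧ c = (Cost.test 0).seq (c₁.seq (Cost.test 0)))
  | loop t P Q u, s, s', c =>
      t.holds s ∧ ∃ c₁, LoopRun t (P.Run w) (Q.Run w) u s s' c₁ ∧ c = (Cost.test 0).seq c₁
  | ite t P Q, s, s', c =>
      (t.holds s ∧ ∃ c₁, P.Run w s s' c₁ ∧ c = (Cost.test 1).seq c₁) ∨
      (¬ t.holds s ∧ ∃ c₁, Q.Run w s s' c₁ ∧ c = (Cost.test 1).seq c₁)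
  | Prog.while t P, s, s', c => WhileRun t (P.Run w) s s' c

/-- Registers mentioned in an instruction. -/
def Instr.regs : Instr → Finset ℕ
  | addC x _ | subC x _ | not x => {x}
  | add x _ y z | sub x _ y z => {x, y, z}
  | swap x y | set x y | andSet x y | orSet x y => {x, y}
  | load x p l | unload x p l | store x p l | unstore x p l | memSet x p l => {x, p, l}
  | keyLe x a b | keyUnLe x a b => {x, a, b}
  | keyCopy a b | keyUnCopy a b | keySwap a b | keySet a b => {a, b}

/-- Registers mentioned in a test. -/
def Test.regs : Test → Finset ℕ
  | eqC x _ => {x}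
  | eq x y | le x y | lt x y => {x, y}
  | not t => t.regs
  | and t u => t.regs ∪ u.regs

/-- Registers mentioned in a program. -/
def Prog.regs : Prog → Finset ℕ
  | skip => ∅
  | instr i => i.regs
  | seq P Q => P.regs ∪ Q.regs
  | branch t P Q u | loop t P Q u => t.regs ∪ P.regs ∪ Q.regs ∪ u.regs
  | ite t P Q => t.regs ∪ P.regs ∪ Q.regs
  | Prog.while t P => t.regs ∪ P.regs

/-- Auxiliary space in bits of a run of the program `P` with resources `c` whose input consists of
`n` keys of `d` bits in the cells `0, …, n - 1`: the bit memory, the key cells other than those of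
the input, and the registers, which have `w` bits each. -/
def auxSpace (P : Prog) (n d w : ℕ) (c : Cost) : ℕ :=
  c.bits + (c.keys - n) * d + P.regs.card * w

end EnergyRAM

namespace EnergyRAM

/-! ### Costs -/

/-! A machine that discards nothing cannot forget; temporary data must be removed by running its
computation backwards. `Prog.Run.inv` shows that a program with reversible instructions and paired
joins can be run backwards at the same cost, and `Exec.wth` turns this into the pattern compute,
use, uncompute. It clears addresses and lengths as well as whole sorted copies.

Merging needs no record of its decisions if the source is kept. The target is followed by a gap as
long as the source and is filled from the right. The flag that tells where the last key came from is
cleared by comparing this key with the source key at the current source index. That source key is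
either the original of the placed key or, because ties go to the target, strictly larger
(`mergeStep_source`, `mergeStep_target`, `mergeInto_exec`).

Bottom-up merge sort by such merges keeps all its levels, which for the whole input would mean about
`lg n` copies of it. Hence the input is cut into `e = n.size` blocks of length `B`, about `n / e`,
so that the `e + 1` levels of one block occupy only `O(n)` cells. Each block is sorted in the
working storage (`sortBlock_exec`), merged into the output, and unsorted again
(`processBlock_exec`). Unsorting works because the sorting of a block does not depend on the output.
Sorting, merging and unsorting take `O(n)` time per block, hence `O(n lg n)` in all
(`sortProg_exec`).

For the lower bounds, the merges fill `min ((i + 1) * B) n` cells for `i < e`, on average at least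
half of `n` (`le_two_mul_sum_min`); and the last output cell changes, so it has been accessed
(`Prog.Run.key`). The bit memory is never used. -/

theorem Cost.seq_comm (a b : Cost) : a.seq b = b.seq a := by
  ext <;> simp [Cost.seq, Nat.add_comm, Nat.max_comm]

theorem Cost.seq_assoc (a b c : Cost) : (a.seq b).seq c = a.seq (b.seq c) := by
  ext <;> simp [Cost.seq, Nat.add_assoc, Nat.max_assoc]

instance : Std.Commutative Cost.seq := ⟨Cost.seq_comm⟩
instance : Std.Associative Cost.seq := ⟨Cost.seq_assoc⟩

theorem Cost.seq_test_cancel {a b : Cost} (h : a.seq (Cost.test 0) = b.seq (Cost.test 0)) :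
    a = b := by
  rw [Cost.ext_iff] at h ⊢
  simpa [Cost.seq, Cost.test] using h

/-! ### Inversion of reversible programs -/

/-- The inverse of a reversible instruction; irreversible instructions are left alone. -/
def Instr.inv : Instr → Instr
  | addC x k => subC x k
  | subC x k => addC x k
  | add x op y z => sub x op y z
  | sub x op y z => add x op y z
  | load x p l => unload x p l
  | unload x p l => load x p l
  | store x p l => unstore x p l
  | unstore x p l => store x p l
  | keyLe x a b => keyUnLe x a b
  | keyUnLe x a b => keyLe x a b
  | keyCopy a b => keyUnCopy a b
  | keyUnCopy a b => keyCopy a b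
  | i => i

/-- The program that runs backwards through `P`. -/
def Prog.inv : Prog → Prog
  | skip => skip
  | instr i => instr i.inv
  | seq P Q => seq Q.inv P.inv
  | branch t P Q u => branch u P.inv Q.inv t
  | loop t P Q u => loop u P.inv Q.inv t
  | P => P

/-- The instruction works on registers and keys only and discards nothing. -/
def Instr.isRev : Instr → Bool
  | addC .. | subC .. | add .. | sub .. | not .. | swap .. => true
  | keyLe .. | keyUnLe .. | keyCopy .. | keyUnCopy .. | keySwap .. => true
  | _ => false

/-- All instructions and all joins of the program are reversible. -/
def Prog.isRev : Prog → Bool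
  | skip => true
  | instr i => i.isRev
  | seq P Q => P.isRev && Q.isRev
  | branch _ P Q _ | loop _ P Q _ => P.isRev && Q.isRev
  | _ => false

/-- All registers hold words of `w` bits. -/
def State.Fits {d : ℕ} (w : ℕ) (s : State d) : Prop := ∀ x, s.reg x < 2 ^ w

variable {d w : ℕ}

theorem State.Fits.setReg {s : State d} (h : s.Fits w) {x v : ℕ} (hv : v < 2 ^ w) :
    (s.setReg x v).Fits w := by
  intro y
  by_cases hy : y = x
  · subst hy; simpa [State.setReg] using hv
  · simpa [State.setReg, Function.update_of_ne hy] using h y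

theorem State.setReg_reg (s : State d) (x v : ℕ) : (s.setReg x v).reg x = v := by
  simp [State.setReg]

theorem State.setReg_reg_ne (s : State d) {x y : ℕ} (v : ℕ) (h : y ≠ x) :
    (s.setReg x v).reg y = s.reg y := by
  simp [State.setReg, h]

theorem State.setReg_setReg (s : State d) (x v v' : ℕ) :
    (s.setReg x v).setReg x v' = s.setReg x v' := by
  simp [State.setReg]

theorem State.setReg_self (s : State d) (x : ℕ) : s.setReg x (s.reg x) = s := by
  simp [State.setReg]

/-- The operands that determine an in-place update are not changed by it, so the same value can be
computed again and taken back. `Fits` supplies the overflow check when the inverse is an addition: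
the sum is the old word. -/
theorem Instr.exec_inv (hw : 1 ≤ w) {i : Instr} (hi : i.isRev = true) {s s' : State d} {c : Cost}
    (hs : s.Fits w) (h : i.exec w s = some (s', c)) :
    s'.Fits w ∧ i.inv.exec w s' = some (s, c) := by
  have h2 : 1 < 2 ^ w := Nat.one_lt_two_pow (by omega)
  cases i with
  | addC x k =>
    simp only [exec, Option.ite_none_right_eq_some, Option.some.injEq, Prod.mk.injEq] at h
    obtain ⟨h1, rfl, rfl⟩ := h
    refine ⟨hs.setReg h1, ?_⟩
    simp [inv, exec, State.setReg_reg, State.setReg_setReg, State.setReg_self]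
  | subC x k =>
    simp only [exec, Option.ite_none_right_eq_some, Option.some.injEq, Prod.mk.injEq] at h
    obtain ⟨h1, rfl, rfl⟩ := h
    have := hs x
    refine ⟨hs.setReg (by omega), ?_⟩
    simp [inv, exec, State.setReg_reg, State.setReg_setReg, Nat.sub_add_cancel h1,
      State.setReg_self, this]
  | add x op y z =>
    simp only [exec, Option.ite_none_right_eq_some, Option.some.injEq, Prod.mk.injEq] at h
    obtain ⟨⟨h1, h2, h3⟩, rfl, rfl⟩ := h
    refine ⟨hs.setReg h3, ?_⟩
    simp [inv, exec, State.setReg_reg, State.setReg_setReg, State.setReg_self,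
      State.setReg_reg_ne _ _ h1.symm, State.setReg_reg_ne _ _ h2.symm, h1, h2]
  | sub x op y z =>
    simp only [exec, Option.ite_none_right_eq_some, Option.some.injEq, Prod.mk.injEq] at h
    obtain ⟨⟨h1, h2, h3⟩, rfl, rfl⟩ := h
    have := hs x
    refine ⟨hs.setReg (by omega), ?_⟩
    simp [inv, exec, State.setReg_reg, State.setReg_setReg, State.setReg_self,
      State.setReg_reg_ne _ _ h1.symm, State.setReg_reg_ne _ _ h2.symm, h1, h2,
      Nat.sub_add_cancel h3, this]
  | not x =>
    simp only [exec, Option.ite_none_right_eq_some, Option.some.injEq, Prod.mk.injEq] at h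
    obtain ⟨h1, rfl, rfl⟩ := h
    refine ⟨hs.setReg (by omega), ?_⟩
    simp [inv, exec, State.setReg_reg, State.setReg_setReg, State.setReg_self,
      show 1 - (1 - s.reg x) = s.reg x by omega]
  | swap x y =>
    simp only [exec, Option.some.injEq, Prod.mk.injEq] at h
    obtain ⟨rfl, rfl⟩ := h
    refine ⟨(hs.setReg (hs y)).setReg (hs x), ?_⟩
    simp only [inv, exec, Option.some.injEq, Prod.mk.injEq, and_true]
    ext z <;> simp only [State.setReg, Function.update_apply]
    split_ifs <;> simp_all
  | keyLe x a b =>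
    simp only [exec, Option.ite_none_right_eq_some, Option.some.injEq, Prod.mk.injEq] at h
    obtain ⟨⟨h1, h2, h3, h4, h5⟩, rfl, rfl⟩ := h
    refine ⟨hs.setReg h5, ?_⟩
    have hk : ∀ v, (s.setReg x v).key = s.key := fun _ => rfl
    simp [inv, exec, State.setReg_reg, State.setReg_setReg, State.setReg_self,
      State.setReg_reg_ne _ _ h1.symm, State.setReg_reg_ne _ _ h2.symm, h1, h2, h3, h4, hk]
  | keyUnLe x a b =>
    simp only [exec, Option.ite_none_right_eq_some, Option.some.injEq, Prod.mk.injEq] at h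
    obtain ⟨⟨h1, h2, h3, h4, h5⟩, rfl, rfl⟩ := h
    have := hs x
    refine ⟨hs.setReg (by omega), ?_⟩
    have hk : ∀ v, (s.setReg x v).key = s.key := fun _ => rfl
    simp [inv, exec, State.setReg_reg, State.setReg_setReg, State.setReg_self,
      State.setReg_reg_ne _ _ h1.symm, State.setReg_reg_ne _ _ h2.symm, h1, h2, h3, h4, hk,
      Nat.sub_add_cancel h5, this]
  | keyCopy a b =>
    simp only [exec, Option.ite_none_right_eq_some, Option.some.injEq, Prod.mk.injEq] at h
    obtain ⟨⟨h1, h2⟩, rfl, rfl⟩ := h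
    -- One cell is occupied and the other empty; this gives the distinctness that uncopying demands.
    have hab : s.reg a ≠ s.reg b := fun h => by simp [h, h2] at h1
    refine ⟨hs, ?_⟩
    simp only [inv, exec, State.setKey, Function.update_self, Function.update_of_ne hab,
      Function.update_idem, hab, h1, ne_eq, not_false_eq_true, and_true, if_true]
    rw [← h2, Function.update_eq_self]
  | keyUnCopy a b =>
    simp only [exec, Option.ite_none_right_eq_some, Option.some.injEq, Prod.mk.injEq] at h
    obtain ⟨⟨hab, h1, h2⟩, rfl, rfl⟩ := h
    refine ⟨hs, ?_⟩
    simp only [inv, exec, State.setKey, Function.update_self, Function.update_of_ne hab,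
      Function.update_idem, h1, and_true, if_true]
    rw [← h2, Function.update_eq_self]
  | keySwap a b =>
    simp only [exec, Option.some.injEq, Prod.mk.injEq] at h
    obtain ⟨rfl, rfl⟩ := h
    refine ⟨hs, ?_⟩
    simp only [inv, exec, State.setKey, Option.some.injEq, Prod.mk.injEq, and_true]
    ext1 <;> try rfl
    funext z
    simp only [Function.update_apply]
    split_ifs <;> simp_all
  | _ => simp [isRev] at hi

/-- The forward run is unfolded from its start, whereas the backward run has to be assembled from
its end. Hence the accumulator `hz`: from the loop head `s`, the backward run either stops at the
entry state `z` or goes on by undoing `Q`, and `c₀` is the cost of this remainder, tests included.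
The additional test on the left of the cost identity is the one that `c₀` brings in; it cancels at
the end by `Cost.seq_test_cancel`. -/
theorem LoopRun.inv {t u : Test} {P Q P' Q' : State d → State d → Cost → Prop}
    (hP : ∀ s s' c, s.Fits w → P s s' c → s'.Fits w ∧ P' s' s c)
    (hQ : ∀ s s' c, s.Fits w → Q s s' c → s'.Fits w ∧ Q' s' s c)
    {s s' : State d} {c : Cost} (h : LoopRun t P Q u s s' c) (hs : s.Fits w) (z : State d)
    (c₀ : Cost)
    (hz : (t.holds s ∧ s = z ∧ c₀ = Cost.test 0) ∨
      (¬ t.holds s ∧ ∃ s₁ c₁ c₂, Q' s s₁ c₁ ∧ ¬ u.holds s₁ ∧ LoopRun u P' Q' t s₁ z c₂ ∧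
        c₀ = (Cost.test 0).seq (c₁.seq ((Cost.test 0).seq c₂)))) :
    s'.Fits w ∧ u.holds s' ∧
      ∃ c', LoopRun u P' Q' t s' z c' ∧ c'.seq (Cost.test 0) = c.seq c₀ := by
  induction h generalizing c₀ with
  | @exit s s' c hp hu =>
    obtain ⟨hs', hp'⟩ := hP _ _ _ hs hp
    refine ⟨hs', hu, ?_⟩
    rcases hz with ⟨ht, rfl, rfl⟩ | ⟨ht, s₁, c₁, c₂, hq, hu₁, hl, rfl⟩
    · exact ⟨_, .exit hp' ht, by ac_rfl⟩
    · exact ⟨_, .again hp' ht hq hu₁ hl, by ac_rfl⟩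
  | @again s s₁ s₂ s' c₁ c₂ c hp hu hq ht hl ih =>
    obtain ⟨hs₁, hp'⟩ := hP _ _ _ hs hp
    obtain ⟨hs₂, hq'⟩ := hQ _ _ _ hs₁ hq
    have key : LoopRun u P' Q' t s₁ z (c₁.seq c₀) := by
      rcases hz with ⟨ht, rfl, rfl⟩ | ⟨ht, s₁, c₁, c₂, hq, hu₁, hl, rfl⟩
      · exact .exit hp' ht
      · exact .again hp' ht hq hu₁ hl
    obtain ⟨h1, h2, c', h3, h4⟩ := ih hs₂ _ (Or.inr ⟨ht, _, _, _, hq', hu, key, rfl⟩)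
    exact ⟨h1, h2, c', h3, by rw [h4]; ac_rfl⟩

/-- A reversible program can be undone at the same cost. -/
theorem Prog.Run.inv (hw : 1 ≤ w) : ∀ {P : Prog}, P.isRev = true → ∀ {s s' : State d} {c : Cost},
    s.Fits w → P.Run w s s' c → s'.Fits w ∧ P.inv.Run w s' s c
  | skip, _, s, s', c, hs, h => by
      obtain ⟨rfl, rfl⟩ := h
      exact ⟨hs, rfl, rfl⟩
  | instr i, hi, s, s', c, hs, h => i.exec_inv hw hi hs h
  | seq P Q, hr, s, s', c, hs, h => by
      simp only [isRev, Bool.and_eq_true] at hr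
      obtain ⟨s₁, c₁, c₂, h1, h2, rfl⟩ := h
      obtain ⟨hs₁, h1'⟩ := Prog.Run.inv hw hr.1 hs h1
      obtain ⟨hs₂, h2'⟩ := Prog.Run.inv hw hr.2 hs₁ h2
      exact ⟨hs₂, s₁, c₂, c₁, h2', h1', Cost.seq_comm _ _⟩
  | branch t P Q u, hr, s, s', c, hs, h => by
      simp only [isRev, Bool.and_eq_true] at hr
      rcases h with ⟨ht, hu, c₁, h, rfl⟩ | ⟨ht, hu, c₁, h, rfl⟩
      · obtain ⟨hs', h'⟩ := Prog.Run.inv hw hr.1 hs h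
        exact ⟨hs', Or.inl ⟨hu, ht, c₁, h', rfl⟩⟩
      · obtain ⟨hs', h'⟩ := Prog.Run.inv hw hr.2 hs h
        exact ⟨hs', Or.inr ⟨hu, ht, c₁, h', rfl⟩⟩
  | loop t P Q u, hr, s, s', c, hs, h => by
      simp only [isRev, Bool.and_eq_true] at hr
      obtain ⟨ht, c₁, hl, rfl⟩ := h
      obtain ⟨hs', hu, c', hl', hc⟩ := hl.inv (P' := P.inv.Run w) (Q' := Q.inv.Run w)
        (fun s s' c hs h => Prog.Run.inv hw hr.1 hs h)
        (fun s s' c hs h => Prog.Run.inv hw hr.2 hs h) hs s (Cost.test 0) (Or.inl ⟨ht, rfl, rfl⟩)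
      cases Cost.seq_test_cancel hc
      exact ⟨hs', hu, _, hl', rfl⟩
  | ite .., hr, _, _, _, _, _ => by simp [isRev] at hr
  | Prog.while .., hr, _, _, _, _, _ => by simp [isRev] at hr

/-! ### Cells that change have been accessed -/

/-- This serves the lower bound on space: a cell that changes must lie below the recorded bound on
key addresses. -/
theorem Instr.exec_key {i : Instr} {s s' : State d} {c : Cost} (h : i.exec w s = some (s', c))
    {a : ℕ} (ha : c.keys ≤ a) : s'.key a = s.key a := by
  have hu : ∀ {b v}, b < a → ∀ f : ℕ → Option (Fin (2 ^ d)), Function.update f b v a = f a :=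
    fun hb f => Function.update_of_ne hb.ne' _ _
  cases i <;>
    simp only [exec, Option.ite_none_right_eq_some, Option.some.injEq, Prod.mk.injEq] at h
  case keyCopy =>
    obtain ⟨-, rfl, rfl⟩ := h
    simp only [Cost.onKey] at ha
    exact hu (by omega) _
  case keyUnCopy =>
    obtain ⟨-, rfl, rfl⟩ := h
    simp only [Cost.onKey] at ha
    exact hu (by omega) _
  case keySwap =>
    obtain ⟨rfl, rfl⟩ := h
    simp only [Cost.onKey] at ha
    simp only [State.setKey]
    rw [hu (by omega), hu (by omega)]
  case keySet =>
    obtain ⟨rfl, rfl⟩ := h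
    simp only [Cost.onKey] at ha
    exact hu (by omega) _
  all_goals first
    | (obtain ⟨-, rfl, -⟩ := h; rfl)
    | (obtain ⟨rfl, -⟩ := h; rfl)

theorem LoopRun.key {t u : Test} {P Q : State d → State d → Cost → Prop} {a : ℕ}
    (hP : ∀ s s' c, P s s' c → c.keys ≤ a → s'.key a = s.key a)
    (hQ : ∀ s s' c, Q s s' c → c.keys ≤ a → s'.key a = s.key a)
    {s s' : State d} {c : Cost} (h : LoopRun t P Q u s s' c) (ha : c.keys ≤ a) :
    s'.key a = s.key a := by
  induction h with
  | exit hp _ =>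
    simp only [Cost.seq, max_le_iff] at ha
    exact hP _ _ _ hp ha.1
  | again hp _ hq _ _ ih =>
    simp only [Cost.seq, max_le_iff] at ha
    rw [ih ha.2.2.2.2, hQ _ _ _ hq ha.2.2.1, hP _ _ _ hp ha.1]

theorem WhileRun.key {t : Test} {P : State d → State d → Cost → Prop} {a : ℕ}
    (hP : ∀ s s' c, P s s' c → c.keys ≤ a → s'.key a = s.key a)
    {s s' : State d} {c : Cost} (h : WhileRun t P s s' c) (ha : c.keys ≤ a) :
    s'.key a = s.key a := by
  induction h with
  | exit _ => rfl
  | again _ hp _ ih =>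
    simp only [Cost.seq, max_le_iff] at ha
    rw [ih ha.2.2, hP _ _ _ hp ha.2.1]

/-- Key cells outside the accessed part do not change. -/
theorem Prog.Run.key : ∀ {P : Prog} {s s' : State d} {c : Cost}, P.Run w s s' c →
    ∀ {a : ℕ}, c.keys ≤ a → s'.key a = s.key a
  | skip, s, s', c, h, a, _ => by rw [h.1]
  | instr i, s, s', c, h, a, ha => i.exec_key h ha
  | seq P Q, s, s', c, h, a, ha => by
      obtain ⟨s₁, c₁, c₂, h1, h2, rfl⟩ := h
      simp only [Cost.seq, max_le_iff] at ha
      rw [Prog.Run.key h2 ha.2, Prog.Run.key h1 ha.1]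
  | branch t P Q u, s, s', c, h, a, ha => by
      rcases h with ⟨-, -, c₁, h, rfl⟩ | ⟨-, -, c₁, h, rfl⟩ <;>
        (simp only [Cost.seq, max_le_iff] at ha; exact Prog.Run.key h ha.2.1)
  | loop t P Q u, s, s', c, h, a, ha => by
      obtain ⟨-, c₁, hl, rfl⟩ := h
      simp only [Cost.seq, max_le_iff] at ha
      exact hl.key (fun _ _ _ h ha => Prog.Run.key h ha) (fun _ _ _ h ha => Prog.Run.key h ha) ha.2
  | ite t P Q, s, s', c, h, a, ha => by
      rcases h with ⟨-, c₁, h, rfl⟩ | ⟨-, c₁, h, rfl⟩ <;>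
        (simp only [Cost.seq, max_le_iff] at ha; exact Prog.Run.key h ha.2)
  | Prog.while t P, s, s', c, h, a, ha => WhileRun.key (fun _ _ _ h ha => Prog.Run.key h ha) h ha

open Function (update)

/-! ### Energy-free executions on registers and keys -/

variable {kb : ℕ}

/-- Contents of the registers. -/
abbrev Regs := ℕ → ℕ

/-- Contents of the key cells. -/
abbrev Keys (d : ℕ) := ℕ → Option (Fin (2 ^ d))

/-- The state with empty bit memory. -/
def State.mk' (r : Regs) (k : Keys d) : State d := ⟨r, fun _ => false, k⟩

/-- With word size `w`, the program `P` leads from the registers `r` and the keys `k` to `r'` and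
`k'` without discarding bits and without touching the bit memory or key cells from `kb` on, and
its time lies between `lo` and `hi`. -/
def Exec (w kb : ℕ) (P : Prog) (r : Regs) (k : Keys d) (r' : Regs) (k' : Keys d)
    (lo hi : ℕ) : Prop :=
  ∃ c, P.Run w (.mk' r k) (.mk' r' k') c ∧ c.energy = 0 ∧ c.bits = 0 ∧ c.keys ≤ kb ∧
    lo ≤ c.time ∧ c.time ≤ hi

/-- All registers hold words of `w` bits. -/
def Fits (w : ℕ) (r : Regs) : Prop := ∀ x, r x < 2 ^ w

theorem Fits.update {r : Regs} (h : Fits w r) {x v : ℕ} (hv : v < 2 ^ w) :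
    Fits w (update r x v) := by
  intro y
  by_cases hy : y = x
  · subst hy; simpa using hv
  · simpa [Function.update_of_ne hy] using h y

namespace Exec

variable {P Q : Prog} {r r₁ r' : Regs} {k k₁ k' : Keys d} {lo hi lo₁ hi₁ lo₂ hi₂ : ℕ}

theorem mono (h : Exec w kb P r k r' k' lo₁ hi₁) (hlo : lo ≤ lo₁) (hhi : hi₁ ≤ hi) :
    Exec w kb P r k r' k' lo hi := by
  obtain ⟨c, h, h1, h2, h3, h4, h5⟩ := h
  exact ⟨c, h, h1, h2, h3, hlo.trans h4, h5.trans hhi⟩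

theorem skip : Exec w kb .skip r k r k 0 0 := ⟨_, ⟨rfl, rfl⟩, rfl, rfl, Nat.zero_le _, le_rfl, le_rfl⟩

theorem seq (h₁ : Exec w kb P r k r₁ k₁ lo₁ hi₁) (h₂ : Exec w kb Q r₁ k₁ r' k' lo₂ hi₂) :
    Exec w kb (.seq P Q) r k r' k' (lo₁ + lo₂) (hi₁ + hi₂) := by
  obtain ⟨c, h, h1, h2, h3, h4, h5⟩ := h₁
  obtain ⟨c', h', h1', h2', h3', h4', h5'⟩ := h₂
  exact ⟨_, ⟨_, _, _, h, h', rfl⟩, by simp [Cost.seq, *], by simp [Cost.seq, *],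
    by simp [Cost.seq, *], by simp only [Cost.seq]; omega, by simp only [Cost.seq]; omega⟩

theorem inv (hw : 1 ≤ w) (hP : P.isRev = true) (hr : Fits w r)
    (h : Exec w kb P r k r' k' lo hi) : Exec w kb P.inv r' k' r k lo hi := by
  obtain ⟨c, h, h'⟩ := h
  have hs : (State.mk' r k).Fits w := hr
  exact ⟨c, (Prog.Run.inv hw hP hs h).2, h'⟩

theorem branch_pos {t u : Test} (ht : t.holds (.mk' r k)) (hu : u.holds (.mk' r' k'))
    (h : Exec w kb P r k r' k' lo hi) : Exec w kb (.branch t P Q u) r k r' k' lo (hi + 2) := by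
  obtain ⟨c, h, h1, h2, h3, h4, h5⟩ := h
  exact ⟨_, Or.inl ⟨ht, hu, c, h, rfl⟩, by simp [Cost.seq, Cost.test, *],
    by simp [Cost.seq, Cost.test, *], by simp [Cost.seq, Cost.test, *],
    by simp only [Cost.seq, Cost.test]; omega, by simp only [Cost.seq, Cost.test]; omega⟩

theorem branch_neg {t u : Test} (ht : ¬ t.holds (.mk' r k)) (hu : ¬ u.holds (.mk' r' k'))
    (h : Exec w kb Q r k r' k' lo hi) : Exec w kb (.branch t P Q u) r k r' k' lo (hi + 2) := by
  obtain ⟨c, h, h1, h2, h3, h4, h5⟩ := h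
  exact ⟨_, Or.inr ⟨ht, hu, c, h, rfl⟩, by simp [Cost.seq, Cost.test, *],
    by simp [Cost.seq, Cost.test, *], by simp [Cost.seq, Cost.test, *],
    by simp only [Cost.seq, Cost.test]; omega, by simp only [Cost.seq, Cost.test]; omega⟩

theorem addC {x v : ℕ} (h : r x + v < 2 ^ w) :
    Exec w kb (.instr (.addC x v)) r k (update r x (r x + v)) k 1 1 :=
  ⟨_, if_pos h, rfl, rfl, Nat.zero_le _, le_rfl, le_rfl⟩

theorem subC {x v : ℕ} (h : v ≤ r x) :
    Exec w kb (.instr (.subC x v)) r k (update r x (r x - v)) k 1 1 :=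
  ⟨_, if_pos h, rfl, rfl, Nat.zero_le _, le_rfl, le_rfl⟩

theorem add {x y z : ℕ} {op : BinOp} (hy : x ≠ y) (hz : x ≠ z)
    (h : r x + op.eval (r y) (r z) < 2 ^ w) :
    Exec w kb (.instr (.add x op y z)) r k (update r x (r x + op.eval (r y) (r z))) k 1 1 :=
  ⟨_, if_pos ⟨hy, hz, h⟩, rfl, rfl, Nat.zero_le _, le_rfl, le_rfl⟩

theorem sub {x y z : ℕ} {op : BinOp} (hy : x ≠ y) (hz : x ≠ z)
    (h : op.eval (r y) (r z) ≤ r x) :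
    Exec w kb (.instr (.sub x op y z)) r k (update r x (r x - op.eval (r y) (r z))) k 1 1 :=
  ⟨_, if_pos ⟨hy, hz, h⟩, rfl, rfl, Nat.zero_le _, le_rfl, le_rfl⟩

theorem not {x : ℕ} (h : r x ≤ 1) :
    Exec w kb (.instr (.not x)) r k (update r x (1 - r x)) k 1 1 :=
  ⟨_, if_pos h, rfl, rfl, Nat.zero_le _, le_rfl, le_rfl⟩

theorem keyLe {x a b : ℕ} {u v : Fin (2 ^ d)} (ha : x ≠ a) (hb : x ≠ b)
    (hu : k (r a) = some u) (hv : k (r b) = some v) (hw : r x + 1 < 2 ^ w)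
    (hak : r a < kb) (hbk : r b < kb) :
    Exec w kb (.instr (.keyLe x a b)) r k (update r x (r x + if u ≤ v then 1 else 0)) k 1 1 := by
  refine ⟨Cost.onKey 0 (r a) (r b), ?_, rfl, rfl, ?_, le_rfl, le_rfl⟩
  · simp only [Prog.Run, Instr.exec, State.mk', hu, hv, keyLeVal]
    rw [if_pos ⟨ha, hb, rfl, rfl, by split_ifs <;> omega⟩]
    rfl
  · simp only [Cost.onKey]; omega

theorem keyUnLe {x a b : ℕ} {u v : Fin (2 ^ d)} (ha : x ≠ a) (hb : x ≠ b)
    (hu : k (r a) = some u) (hv : k (r b) = some v) (hx : (if u ≤ v then 1 else 0) ≤ r x)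
    (hak : r a < kb) (hbk : r b < kb) :
    Exec w kb (.instr (.keyUnLe x a b)) r k (update r x (r x - if u ≤ v then 1 else 0)) k 1 1 := by
  refine ⟨Cost.onKey 0 (r a) (r b), ?_, rfl, rfl, ?_, le_rfl, le_rfl⟩
  · simp only [Prog.Run, Instr.exec, State.mk', hu, hv, keyLeVal]
    rw [if_pos ⟨ha, hb, rfl, rfl, hx⟩]
    rfl
  · simp only [Cost.onKey]; omega

theorem keyCopy {a b : ℕ} {u : Fin (2 ^ d)} (ha : k (r a) = some u) (hb : k (r b) = none)
    (hak : r a < kb) (hbk : r b < kb) :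
    Exec w kb (.instr (.keyCopy a b)) r k r (update k (r b) (some u)) 1 1 := by
  refine ⟨Cost.onKey 0 (r a) (r b), ?_, rfl, rfl, ?_, le_rfl, le_rfl⟩
  · simp [Prog.Run, Instr.exec, State.mk', ha, hb, State.setKey]
  · simp only [Cost.onKey]; omega

theorem keySwap {a b : ℕ} (hak : r a < kb) (hbk : r b < kb) :
    Exec w kb (.instr (.keySwap a b)) r k r (update (update k (r a) (k (r b))) (r b) (k (r a)))
      1 1 := by
  refine ⟨Cost.onKey 0 (r a) (r b), rfl, rfl, rfl, ?_, le_rfl, le_rfl⟩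
  simp only [Cost.onKey]; omega

/-- A two-way loop whose test part is empty and whose body is executed `N` times. -/
theorem loop {t u : Test} (N : ℕ) (Inv : ℕ → Regs → Keys d → Prop) (lo : ℕ → ℕ) (hi : ℕ)
    (ht : ∀ i r k, Inv i r k → (t.holds (.mk' r k) ↔ i = 0))
    (hu : ∀ i r k, i ≤ N → Inv i r k → (u.holds (.mk' r k) ↔ i = N))
    (body : ∀ i < N, ∀ r k, Inv i r k →
      ∃ r' k', Exec w kb Q r k r' k' (lo i) hi ∧ Inv (i + 1) r' k')
    (h0 : Inv 0 r k) :
    ∃ r' k', Exec w kb (.loop t .skip Q u) r k r' k' (∑ i ∈ Finset.range N, (lo i + 1))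
      (N * (hi + 2) + 2) ∧ Inv N r' k' := by
  have main : ∀ m i, i + m = N → ∀ r k, Inv i r k → ∃ r' k' c, Inv N r' k' ∧
      LoopRun t (Prog.skip.Run w) (Q.Run w) u (.mk' r k) (.mk' r' k') c ∧ c.energy = 0 ∧
      c.bits = 0 ∧ c.keys ≤ kb ∧ ∑ j ∈ Finset.range m, (lo (i + j) + 1) ≤ c.time ∧
      c.time ≤ m * (hi + 2) + 1 := by
    intro m
    induction m with
    | zero =>
      intro i hi r k h
      have hi : i = N := by omega
      subst hi
      refine ⟨r, k, _, h, .exit ⟨rfl, rfl⟩ ((hu _ _ _ le_rfl h).2 rfl), ?_⟩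
      simp [Cost.seq, Cost.test]
    | succ m ih =>
      intro i hi r k h
      obtain ⟨r', k', ⟨c, hq, h1, h2, h3, h4, h5⟩, h'⟩ := body i (by omega) r k h
      obtain ⟨r'', k'', c', h'', hl, h1', h2', h3', h4', h5'⟩ := ih (i + 1) (by omega) r' k' h'
      refine ⟨r'', k'', _, h'', .again ⟨rfl, rfl⟩ (fun h0 => ?_) hq (fun h0 => ?_) hl, ?_⟩
      · have := (hu _ _ _ (by omega) h).1 h0
        omega
      · have := (ht _ _ _ h').1 h0
        omega
      · rw [Finset.sum_range_succ']
        simp only [add_assoc, add_comm 1] at h4'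
        simp [Cost.seq, Cost.test, h1, h2, h3, h1', h2', h3', Nat.add_mul]
        constructor
        · omega
        · omega
  obtain ⟨r', k', c, h, hl, h1, h2, h3, h4, h5⟩ := main N 0 (by omega) r k h0
  refine ⟨r', k', ⟨_, ⟨(ht _ _ _ h0).2 rfl, c, hl, rfl⟩, ?_⟩, h⟩
  simp only [Nat.zero_add] at h4
  simp only [Cost.seq, Cost.test, h1, h2]
  exact ⟨by simp, by simp, by simpa using h3, by omega, by omega⟩

end Exec

/-- Execute `Q` for all values of the register `x` from `0` to that of `y`, exclusively. -/
def forLoop (x y : ℕ) (Q : Prog) : Prog :=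
  .seq (.loop (.eqC x 0) .skip (.seq Q (.instr (.addC x 1))) (.eq x y)) (.instr (.sub x .left y y))

/-- Invariants describe the registers with the counter at `0`, and only the body sees its value,
through `update`. The final subtraction of `y` makes this true again at the end. `N = 0` is covered
because the exit test precedes the body. -/
theorem Exec.forLoop {x y : ℕ} {Q : Prog} (hxy : x ≠ y) (N : ℕ) (hN : N < 2 ^ w)
    (Inv : ℕ → Regs → Keys d → Prop) (lo : ℕ → ℕ) (hi : ℕ)
    (hInv : ∀ i r k, Inv i r k → r x = 0 ∧ r y = N)
    (body : ∀ i < N, ∀ r k, Inv i r k →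
      ∃ r' k', Exec w kb Q (update r x i) k (update r' x i) k' (lo i) hi ∧ Inv (i + 1) r' k')
    {r : Regs} {k : Keys d} (h0 : Inv 0 r k) :
    ∃ r' k', Exec w kb (EnergyRAM.forLoop x y Q) r k r' k' (∑ i ∈ Finset.range N, (lo i + 1))
      (N * (hi + 3) + 3) ∧ Inv N r' k' := by
  obtain ⟨r', k', h, r'', rfl, h'⟩ := Exec.loop (w := w) (kb := kb)
    (Q := .seq Q (.instr (.addC x 1))) (t := .eqC x 0) (u := .eq x y) (r := r) (k := k) N
    (fun i r k => ∃ r₀, r = update r₀ x i ∧ Inv i r₀ k) lo (hi + 1)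
    (fun i r k ⟨r₀, hr, _⟩ => by simp [Test.holds, State.mk', hr])
    (fun i r k _ ⟨r₀, hr, h⟩ => by
      simp [Test.holds, State.mk', hr, hxy.symm, (hInv _ _ _ h).2])
    (fun i hiN r k ⟨r₀, hr, h⟩ => by
      obtain ⟨r', k', hq, h'⟩ := body i hiN r₀ k h
      refine ⟨update r' x (i + 1), k', ?_, r', rfl, h'⟩
      have := (hr ▸ hq).seq (Exec.addC (x := x) (v := 1) (by simp; omega))
      simpa using this.mono (Nat.le_add_right _ _) le_rfl)
    ⟨r, by rw [← (hInv _ _ _ h0).1, Function.update_eq_self], h0⟩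
  refine ⟨r'', k', ?_, h'⟩
  have hs := h.seq (Exec.sub (w := w) (kb := kb) (x := x) (y := y) (z := y) (op := .left) (k := k')
    hxy hxy (by simp [BinOp.eval, hxy.symm, (hInv _ _ _ h').2]))
  have e : update (update r'' x N) x (update r'' x N x -
      BinOp.left.eval (update r'' x N y) (update r'' x N y)) = r'' := by
    simp [BinOp.eval, hxy.symm, (hInv _ _ _ h').2]
    exact ((hInv _ _ _ h').1).symm
  rw [e] at hs
  exact hs.mono (Nat.le_add_right _ _) le_rfl

/-! ### Straight-line computations on registers -/

/-- Sequence of instructions. -/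
def block : List Instr → Prog
  | [] => .skip
  | i :: l => .seq (.instr i) (block l)

/-- Effect of additions and subtractions on the registers. -/
def regEval : List Instr → Regs → Regs
  | [], r => r
  | .addC x v :: l, r => regEval l (update r x (r x + v))
  | .subC x v :: l, r => regEval l (update r x (r x - v))
  | .add x op y z :: l, r => regEval l (update r x (r x + op.eval (r y) (r z)))
  | .sub x op y z :: l, r => regEval l (update r x (r x - op.eval (r y) (r z)))
  | _ :: l, r => regEval l r

/-- The additions and subtractions are defined. -/
def RegOK (w : ℕ) : List Instr → Regs → Prop
  | [], _ => True
  | .addC x v :: l, r => r x + v < 2 ^ w ∧ RegOK w l (update r x (r x + v))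
  | .subC x v :: l, r => v ≤ r x ∧ RegOK w l (update r x (r x - v))
  | .add x op y z :: l, r => x ≠ y ∧ x ≠ z ∧ r x + op.eval (r y) (r z) < 2 ^ w ∧
      RegOK w l (update r x (r x + op.eval (r y) (r z)))
  | .sub x op y z :: l, r => x ≠ y ∧ x ≠ z ∧ op.eval (r y) (r z) ≤ r x ∧
      RegOK w l (update r x (r x - op.eval (r y) (r z)))
  | _ :: _, _ => False

theorem Exec.block {l : List Instr} {r : Regs} (h : RegOK w l r) (k : Keys d) :
    Exec w kb (block l) r k (regEval l r) k 0 l.length := by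
  induction l generalizing r with
  | nil => exact Exec.skip
  | cons i l ih =>
    cases i <;> simp only [RegOK] at h
    case addC x v =>
      exact ((Exec.addC h.1).seq (ih h.2)).mono (by omega) (by simp; omega)
    case subC x v =>
      exact ((Exec.subC h.1).seq (ih h.2)).mono (by omega) (by simp; omega)
    case add x op y z =>
      exact ((Exec.add h.1 h.2.1 h.2.2.1).seq (ih h.2.2.2)).mono (by omega) (by simp; omega)
    case sub x op y z =>
      exact ((Exec.sub h.1 h.2.1 h.2.2.1).seq (ih h.2.2.2)).mono (by omega) (by simp; omega)

theorem RegOK.isRev {l : List Instr} {r : Regs} (h : RegOK w l r) : (block l).isRev = true := by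
  induction l generalizing r with
  | nil => rfl
  | cons i l ih =>
    cases i <;> simp only [RegOK] at h
    case addC x v => simp [block, Prog.isRev, Instr.isRev, ih h.2]
    case subC x v => simp [block, Prog.isRev, Instr.isRev, ih h.2]
    case add x op y z => simp [block, Prog.isRev, Instr.isRev, ih h.2.2.2]
    case sub x op y z => simp [block, Prog.isRev, Instr.isRev, ih h.2.2.2]

theorem RegOK.fits {l : List Instr} {r : Regs} (h : RegOK w l r) (hr : Fits w r) :
    Fits w (regEval l r) := by
  induction l generalizing r with
  | nil => exact hr
  | cons i l ih =>
    cases i <;> simp only [RegOK] at h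
    case addC x v => exact ih h.2 (hr.update h.1)
    case subC x v => exact ih h.2 (hr.update ((Nat.sub_le _ _).trans_lt (hr x)))
    case add x op y z => exact ih h.2.2.2 (hr.update h.2.2.1)
    case sub x op y z => exact ih h.2.2.2 (hr.update ((Nat.sub_le _ _).trans_lt (hr x)))

/-! ### Computing, using and uncomputing auxiliary data -/

/-- Compute auxiliary values, execute `Q`, and clear the auxiliary values again. -/
def wth (A Q : Prog) : Prog := .seq A (.seq Q A.inv)

/-- The two uses of `A` may concern different states. It suffices that `A`, run on the desired final
state, would produce what `Q` leaves behind; the inverse of this hypothetical run does the clearing.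
-/
theorem Exec.wth (hw : 1 ≤ w) {A Q : Prog} (hA : A.isRev = true) {r r₁ r₂ r' : Regs}
    {k k₁ k₂ k' : Keys d} {lo hi lo₁ hi₁ : ℕ} (hr' : Fits w r')
    (h₁ : Exec w kb A r k r₁ k₁ lo₁ hi₁) (h : Exec w kb Q r₁ k₁ r₂ k₂ lo hi)
    (h₂ : Exec w kb A r' k' r₂ k₂ lo₁ hi₁) :
    Exec w kb (EnergyRAM.wth A Q) r k r' k' lo (hi + 2 * hi₁) :=
  (h₁.seq (h.seq (h₂.inv hw hA hr'))).mono (by omega) (by omega)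

theorem Exec.wthBlock (hw : 1 ≤ w) {l : List Instr} {Q : Prog} {r r' : Regs}
    {k k' : Keys d} {lo hi : ℕ} (hr' : Fits w r') (h₁ : RegOK w l r) (h₂ : RegOK w l r')
    (h : Exec w kb Q (regEval l r) k (regEval l r') k' lo hi) :
    Exec w kb (EnergyRAM.wth (EnergyRAM.block l) Q) r k r' k' lo (hi + 2 * l.length) :=
  Exec.wth hw h₁.isRev hr' (Exec.block h₁ k) h (Exec.block h₂ k')

/-- This permits a result to be left in `y` while the parameters computed by `l` are cleared around
it (`Exec.wthBlock_update`). -/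
theorem regEval_update {l : List Instr} {y : ℕ} (hy : ∀ i ∈ l, y ∉ i.regs) (r : Regs) (v : ℕ) :
    regEval l (update r y v) = update (regEval l r) y v := by
  induction l generalizing r with
  | nil => rfl
  | cons i l ih =>
    have ih := ih fun i hi => hy i (List.mem_cons_of_mem _ hi)
    have hi := hy i List.mem_cons_self
    cases i <;> simp only [Instr.regs, Finset.mem_insert, Finset.mem_singleton, not_or] at hi <;>
      simp only [regEval]
    case addC x v => rw [Function.update_of_ne (Ne.symm hi), Function.update_comm (by tauto), ih]
    case subC x v => rw [Function.update_of_ne (Ne.symm hi), Function.update_comm (by tauto), ih]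
    case add x op a b =>
      rw [Function.update_of_ne (Ne.symm hi.1), Function.update_of_ne (Ne.symm hi.2.1),
        Function.update_of_ne (Ne.symm hi.2.2), Function.update_comm (by tauto), ih]
    case sub x op a b =>
      rw [Function.update_of_ne (Ne.symm hi.1), Function.update_of_ne (Ne.symm hi.2.1),
        Function.update_of_ne (Ne.symm hi.2.2), Function.update_comm (by tauto), ih]
    all_goals exact ih _

theorem RegOK.update {l : List Instr} {y : ℕ} (hy : ∀ i ∈ l, y ∉ i.regs) {r : Regs} {v : ℕ}
    (h : RegOK w l r) : RegOK w l (update r y v) := by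
  induction l generalizing r with
  | nil => trivial
  | cons i l ih =>
    have ih := fun r => ih (r := r) fun i hi => hy i (List.mem_cons_of_mem _ hi)
    have hi := hy i List.mem_cons_self
    cases i <;> simp only [Instr.regs, Finset.mem_insert, Finset.mem_singleton, not_or] at hi <;>
      simp only [RegOK] at h ⊢
    case addC x v =>
      rw [Function.update_of_ne (Ne.symm hi), Function.update_comm (by tauto)]
      exact ⟨h.1, ih _ h.2⟩
    case subC x v =>
      rw [Function.update_of_ne (Ne.symm hi), Function.update_comm (by tauto)]
      exact ⟨h.1, ih _ h.2⟩
    case add x op a b =>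
      rw [Function.update_of_ne (Ne.symm hi.1), Function.update_of_ne (Ne.symm hi.2.1),
        Function.update_of_ne (Ne.symm hi.2.2), Function.update_comm (by tauto)]
      exact ⟨h.1, h.2.1, h.2.2.1, ih _ h.2.2.2⟩
    case sub x op a b =>
      rw [Function.update_of_ne (Ne.symm hi.1), Function.update_of_ne (Ne.symm hi.2.1),
        Function.update_of_ne (Ne.symm hi.2.2), Function.update_comm (by tauto)]
      exact ⟨h.1, h.2.1, h.2.2.1, ih _ h.2.2.2⟩

/-- The straight-line program `l` is defined on `r` and yields `r'`. -/
def RegSteps (w : ℕ) (l : List Instr) (r r' : Regs) : Prop := RegOK w l r ∧ regEval l r = r'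

theorem RegSteps.nil (r : Regs) : RegSteps w [] r r := ⟨trivial, rfl⟩

/-- These rules execute a block symbolically, each intermediate value being given in closed form. In
`RegSteps.sub` the value is specified additively, so that truncation does not interfere. -/
theorem RegSteps.add {x y z : ℕ} {op : BinOp} {l : List Instr} {r r' : Regs} (v : ℕ)
    (hv : r x + op.eval (r y) (r z) = v) (hvw : v < 2 ^ w) (hy : x ≠ y) (hz : x ≠ z)
    (h : RegSteps w l (Function.update r x v) r') : RegSteps w (.add x op y z :: l) r r' := by
  subst hv
  exact ⟨⟨hy, hz, hvw, h.1⟩, h.2⟩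

theorem RegSteps.addC {x c : ℕ} {l : List Instr} {r r' : Regs} (v : ℕ) (hv : r x + c = v)
    (hvw : v < 2 ^ w) (h : RegSteps w l (Function.update r x v) r') :
    RegSteps w (.addC x c :: l) r r' := by
  subst hv
  exact ⟨⟨hvw, h.1⟩, h.2⟩

theorem RegSteps.sub {x y z : ℕ} {op : BinOp} {l : List Instr} {r r' : Regs} (v : ℕ)
    (hv : v + op.eval (r y) (r z) = r x) (hy : x ≠ y) (hz : x ≠ z)
    (h : RegSteps w l (Function.update r x v) r') : RegSteps w (.sub x op y z :: l) r r' := by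
  obtain rfl : v = r x - op.eval (r y) (r z) := by omega
  exact ⟨⟨hy, hz, by omega, h.1⟩, h.2⟩

theorem Exec.wthBlock_update (hw : 1 ≤ w) {l : List Instr} {Q : Prog} {r : Regs} {k k' : Keys d}
    {lo hi y v : ℕ} (hr : Fits w r) (hv : v < 2 ^ w) (hy : ∀ i ∈ l, y ∉ i.regs) (h₁ : RegOK w l r)
    (h : Exec w kb Q (regEval l r) k (update (regEval l r) y v) k' lo hi) :
    Exec w kb (EnergyRAM.wth (EnergyRAM.block l) Q) r k (Function.update r y v) k' lo
      (hi + 2 * l.length) :=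
  Exec.wthBlock hw (hr.update hv) h₁ (h₁.update hy) (by rwa [regEval_update hy])

theorem Exec.wthBlock_self (hw : 1 ≤ w) {l : List Instr} {Q : Prog} {r : Regs} {k k' : Keys d}
    {lo hi : ℕ} (hr : Fits w r) (h₁ : RegOK w l r)
    (h : Exec w kb Q (regEval l r) k (regEval l r) k' lo hi) :
    Exec w kb (EnergyRAM.wth (EnergyRAM.block l) Q) r k r k' lo (hi + 2 * l.length) :=
  Exec.wthBlock hw hr h₁ h₁ h

theorem Exec.congr {P : Prog} {r r₁ r' : Regs} {k k₁ k' : Keys d} {lo hi : ℕ}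
    (h : Exec w kb P r k r₁ k₁ lo hi) (hr : r₁ = r') (hk : k₁ = k') :
    Exec w kb P r k r' k' lo hi := hr ▸ hk ▸ h

/-! ### Merging a sorted array into another one in place

Registers: `2` holds `1`; `18` the length of the source, `19` its address, `20` the address of the
target, `21` the length of the result.  The result is produced from right to left: `22` counts the
steps, `23` is the number of keys of the source that are still to be merged, `24` the index of the
next cell to be filled and `28` its address, and `25` is a flag that tells whether this cell
receives a key of the source. -/

/-- The next key comes from the source. -/
def mergeDecide : Prog :=
  .branch (.and (.le 2 23) (.le 23 24))
    (wth (block [.add 26 .sub 28 23, .add 27 .add 19 23, .subC 27 1])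
      (.seq (.instr (.keyLe 25 27 26)) (.instr (.not 25))))
    (.instr (.add 25 .le 2 23))
    (.and (.le 2 23) (.le 23 24))

/-- The swap takes the last remaining target key across the gap and leaves an empty cell in its
place. When the gap has closed, both addresses coincide and the swap does nothing. -/
def mergeMove : Prog :=
  .branch (.eqC 25 1)
    (.seq (.instr (.subC 23 1)) (wth (block [.add 27 .add 19 23]) (.instr (.keyCopy 27 28))))
    (wth (block [.add 26 .sub 28 23]) (.instr (.keySwap 26 28)))
    (.eqC 25 1)

/-- The last key came from the source. -/
def mergeUndecide : Prog :=
  .branch (.lt 23 18)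
    (wth (block [.add 27 .add 19 23]) (.instr (.keyUnLe 25 27 28)))
    .skip
    (.lt 23 18)

/-- The parameters depend on the step counter and not on register `23`, so they can be cleared after
the latter has changed. -/
def mergeStep : Prog :=
  wth (block [.add 24 .sub 21 22, .subC 24 1, .add 28 .add 20 24])
    (.seq mergeDecide (.seq mergeMove mergeUndecide))

/-- Merge the source into the target. -/
def mergeInto : Prog := .seq (.instr (.add 23 .left 18 18)) (forLoop 22 21 mergeStep)

/-- Decision between two keys. -/
theorem mergeDecide_keys (hw : 2 ≤ w) {r : Regs} {k : Keys d} (hr : Fits w r) {src b p c : ℕ}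
    (h2 : r 2 = 1) (h19 : r 19 = src) (h23 : r 23 = b) (h24 : r 24 = p) (h25 : r 25 = 0)
    (h26 : r 26 = 0) (h27 : r 27 = 0) (h28 : r 28 = c) {u v : Fin (2 ^ d)} (hb : 1 ≤ b)
    (hbp : b ≤ p) (hu : k (src + b - 1) = some u) (hv : k (c - b) = some v)
    (hs : src + b ≤ kb) (hc : c < kb) (hkb : kb < 2 ^ w) :
    Exec w kb mergeDecide r k (update r 25 (if u ≤ v then 0 else 1)) k 0 10 := by
  have h4 : 1 + 1 < 2 ^ w := by
    calc 1 + 1 < 2 ^ 2 := by norm_num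
      _ ≤ 2 ^ w := Nat.pow_le_pow_right (by norm_num) hw
  refine Exec.branch_pos (lo := 0) (hi := 8) ?_ ?_ ?_
  · simp [Test.holds, State.mk', h2, h23, h24, hb, hbp]
  · simp [Test.holds, State.mk', h2, h23, h24, hb, hbp]
  · refine (Exec.wthBlock_update (lo := 2) (hi := 2) (by omega) hr
      (by split_ifs <;> omega) (by simp [Instr.regs]) ?_ ?_).mono (by omega) le_rfl
    · simp [RegOK, BinOp.eval, h19, h23, h26, h27, h28]
      omega
    · set r₁ := regEval _ r
      have e26 : r₁ 26 = c - b := by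
        simp [r₁, regEval, BinOp.eval, h23, h26, h28]
      have e27 : r₁ 27 = src + b - 1 := by
        simp [r₁, regEval, BinOp.eval, h23, h19, h27]
      have e25 : r₁ 25 = 0 := by
        simp [r₁, regEval, h25]
      refine ((Exec.keyLe (u := u) (v := v) (by decide) (by decide) ?_ ?_ ?_ ?_ ?_).seq
        (Exec.not ?_)).congr ?_ rfl
      · rw [e27, hu]
      · rw [e26, hv]
      · omega
      · omega
      · omega
      · simp [e25]; split_ifs <;> simp
      · simp [e25]; split_ifs <;> simp

/-- Decision when one of the two parts is exhausted. -/
theorem mergeDecide_exhausted (hw : 1 ≤ w) {r : Regs} {k : Keys d} {b p : ℕ}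
    (h2 : r 2 = 1) (h23 : r 23 = b) (h24 : r 24 = p) (h25 : r 25 = 0)
    (hbp : ¬ (1 ≤ b ∧ b ≤ p)) :
    Exec w kb mergeDecide r k (update r 25 (if 1 ≤ b then 1 else 0)) k 0 10 := by
  have h4 : 1 < 2 ^ w := Nat.one_lt_two_pow (by omega)
  refine (Exec.branch_neg (lo := 1) (hi := 1) ?_ ?_ ?_).mono (by omega) (by omega)
  · simpa [Test.holds, State.mk', h2, h23, h24] using hbp
  · simpa [Test.holds, State.mk', h2, h23, h24] using hbp
  · refine (Exec.add (by decide) (by decide) ?_).congr ?_ rfl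
    · simp [BinOp.eval, h2, h23, h25]; split_ifs <;> omega
    · simp [BinOp.eval, h2, h23, h25]

theorem mergeMove_source (hw : 1 ≤ w) {r : Regs} {k : Keys d} (hr : Fits w r) {src b c : ℕ}
    (h19 : r 19 = src) (h23 : r 23 = b) (h25 : r 25 = 1)
    (h27 : r 27 = 0) (h28 : r 28 = c) {u : Fin (2 ^ d)} (hb : 1 ≤ b)
    (hu : k (src + b - 1) = some u) (hk : k c = none)
    (hs : src + b ≤ kb) (hc : c < kb) (hkb : kb < 2 ^ w) :
    Exec w kb mergeMove r k (update r 23 (b - 1)) (update k c (some u)) 0 6 := by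
  refine Exec.branch_pos (lo := 0) (hi := 4) ?_ ?_ ?_
  · simp [Test.holds, State.mk', h25]
  · simp [Test.holds, State.mk', h25]
  · have h1 : Exec w kb (.instr (.subC 23 1)) r k (update r 23 (b - 1)) k 1 1 :=
      (Exec.subC (by omega)).congr (by rw [h23]) rfl
    refine (h1.seq (Exec.wthBlock_self (lo := 1) (hi := 1) hw (hr.update ?_) ?_ ?_)).mono
      (by omega) le_rfl
    · omega
    · simp [RegOK, BinOp.eval, h19, h27]
      omega
    · set r₁ := regEval _ (update r 23 (b - 1))
      have e27 : r₁ 27 = src + b - 1 := by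
        simp [r₁, regEval, BinOp.eval, h19, h27]; omega
      have e28 : r₁ 28 = c := by simp [r₁, regEval, h28]
      refine (Exec.keyCopy (u := u) ?_ ?_ ?_ ?_).congr rfl (by rw [e28])
      · rw [e27, hu]
      · rw [e28, hk]
      · omega
      · omega

theorem mergeMove_target (hw : 1 ≤ w) {r : Regs} {k : Keys d} (hr : Fits w r) {b c : ℕ}
    (h23 : r 23 = b) (h25 : r 25 = 0) (h26 : r 26 = 0) (h28 : r 28 = c) {v : Fin (2 ^ d)}
    (hv : k (c - b) = some v) (hc : c < kb) (hkb : kb < 2 ^ w) :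
    Exec w kb mergeMove r k r (update (update k (c - b) (k c)) c (some v)) 0 6 := by
  refine (Exec.branch_neg (lo := 1) (hi := 3) ?_ ?_ ?_).mono (by omega) (by omega)
  · simp [Test.holds, State.mk', h25]
  · simp [Test.holds, State.mk', h25]
  · refine Exec.wthBlock_self (lo := 1) (hi := 1) hw hr ?_ ?_
    · simp [RegOK, BinOp.eval, h23, h26, h28]
      omega
    · set r₁ := regEval _ r
      have e26 : r₁ 26 = c - b := by simp [r₁, regEval, BinOp.eval, h23, h26, h28]
      have e28 : r₁ 28 = c := by simp [r₁, regEval, h28]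
      refine (Exec.keySwap ?_ ?_).congr rfl (by rw [e28, e26, hv])
      · omega
      · omega

/-- Here `b` is the index after the move, so `u` is the original of the placed key if this came from
the source, and otherwise the source key merged last. -/
theorem mergeUndecide_keys (hw : 1 ≤ w) {r : Regs} {k : Keys d} (hr : Fits w r) {src b lb c : ℕ}
    (h18 : r 18 = lb) (h19 : r 19 = src) (h23 : r 23 = b) (h27 : r 27 = 0) (h28 : r 28 = c)
    {u v : Fin (2 ^ d)} (hb : b < lb) (hu : k (src + b) = some u) (hv : k c = some v)
    (h25 : r 25 = if u ≤ v then 1 else 0) (hs : src + b < kb) (hc : c < kb) (hkb : kb < 2 ^ w) :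
    Exec w kb mergeUndecide r k (update r 25 0) k 0 5 := by
  refine (Exec.branch_pos (lo := 1) (hi := 3) ?_ ?_ ?_).mono (by omega) (by omega)
  · simp [Test.holds, State.mk', h23, h18, hb]
  · simp [Test.holds, State.mk', h23, h18, hb]
  · refine Exec.wthBlock_update (lo := 1) (hi := 1) hw hr (by omega) (by simp [Instr.regs]) ?_ ?_
    · simp [RegOK, BinOp.eval, h19, h23, h27]
      omega
    · set r₁ := regEval _ r
      have e27 : r₁ 27 = src + b := by simp [r₁, regEval, BinOp.eval, h23, h27, h19]
      have e28 : r₁ 28 = c := by simp [r₁, regEval, h28]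
      have e25 : r₁ 25 = if u ≤ v then 1 else 0 := by simp [r₁, regEval, h25]
      refine (Exec.keyUnLe (u := u) (v := v) (by decide) (by decide) ?_ ?_ ?_ ?_ ?_).congr ?_ rfl
      · rw [e27, hu]
      · rw [e28, hv]
      · rw [e25]
      · omega
      · omega
      · rw [e25, Nat.sub_self]

theorem mergeUndecide_skip {r : Regs} {k : Keys d} {b lb : ℕ} (h18 : r 18 = lb) (h23 : r 23 = b)
    (hb : lb ≤ b) : Exec w kb mergeUndecide r k r k 0 5 := by
  refine (Exec.branch_neg (lo := 0) (hi := 0) ?_ ?_ Exec.skip).mono (by omega) (by omega)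
  · simp [Test.holds, State.mk', h23, h18, hb]
  · simp [Test.holds, State.mk', h23, h18, hb]

theorem update_comm_self {r : Regs} {x y v a : ℕ} (hxy : x ≠ y) (hx : r x = a) (v' : ℕ) :
    update (update (update r x v) y v') x a = update r y v' := by
  rw [Function.update_comm hxy, Function.update_idem, ← hx]
  rw [Function.update_comm hxy.symm, Function.update_eq_self]

/-- The registers of `mergeStep`. -/
structure MergeRegs (r : Regs) (src dst lb tot x b : ℕ) : Prop where
  h2 : r 2 = 1
  h18 : r 18 = lb
  h19 : r 19 = src
  h20 : r 20 = dst
  h21 : r 21 = tot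
  h22 : r 22 = x
  h23 : r 23 = b
  h24 : r 24 = 0
  h25 : r 25 = 0
  h26 : r 26 = 0
  h27 : r 27 = 0
  h28 : r 28 = 0

/-- The inequality in `hv` is strict because ties go to the target. If `p < b`, the target is
exhausted and no comparison takes place. -/
theorem mergeStep_source (hw : 2 ≤ w) {r : Regs} {k : Keys d} (hr : Fits w r)
    {src dst lb tot x b p : ℕ} (h : MergeRegs r src dst lb tot x b) (hp : tot = x + p + 1)
    (hb : 1 ≤ b) (hlb : b ≤ lb) {u : Fin (2 ^ d)} (hu : k (src + b - 1) = some u)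
    (hk : k (dst + p) = none)
    (hv : b ≤ p → ∃ v, k (dst + p - b) = some v ∧ v < u)
    (hs : src + lb ≤ kb) (hd : dst + tot ≤ kb) (hkb : kb < 2 ^ w) :
    Exec w kb mergeStep r k (update r 23 (b - 1)) (update k (dst + p) (some u)) 0 27 := by
  obtain ⟨h2, h18, h19, h20, h21, h22, h23, h24, h25, h26, h27, h28⟩ := h
  have hne : src + b - 1 ≠ dst + p := fun e => by rw [e, hk] at hu; cases hu
  refine Exec.wthBlock_update (lo := 0) (hi := 21) (by omega) hr (by omega)
    (by simp [Instr.regs]) ?_ ?_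
  · simp [RegOK, BinOp.eval, h24, h28, h21, h22, h20]
    omega
  · set l : List Instr := [.add 24 .sub 21 22, .subC 24 1, .add 28 .add 20 24] with hl
    have hr₁ : Fits w (regEval l r) := by
      refine RegOK.fits ?_ hr
      simp [hl, RegOK, BinOp.eval, h24, h28, h21, h22, h20]
      omega
    have e24 : regEval l r 24 = p := by
      simp [hl, regEval, BinOp.eval, h24, h21, h22]; omega
    have e28 : regEval l r 28 = dst + p := by
      simp [hl, regEval, BinOp.eval, h24, h21, h22, h28, h20]; omega
    have e : ∀ y, y ≠ 24 → y ≠ 28 → regEval l r y = r y := fun y h h' => by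
      simp [hl, regEval, h, h']
    generalize regEval l r = r₁ at hr₁ e24 e28 e
    have e2 := (e 2 (by decide) (by decide)).trans h2
    have e18 := (e 18 (by decide) (by decide)).trans h18
    have e19 := (e 19 (by decide) (by decide)).trans h19
    have e23 := (e 23 (by decide) (by decide)).trans h23
    have e25 := (e 25 (by decide) (by decide)).trans h25
    have e26 := (e 26 (by decide) (by decide)).trans h26
    have e27 := (e 27 (by decide) (by decide)).trans h27
    have hD : Exec w kb mergeDecide r₁ k (update r₁ 25 1) k 0 10 := by
      by_cases hbp : b ≤ p
      · obtain ⟨v, hv, hvu⟩ := hv hbp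
        have := mergeDecide_keys hw hr₁ e2 e19 e23 e24 e25 e26 e27 e28 hb hbp hu hv (by omega)
          (by omega) hkb
        rwa [if_neg (not_le.2 hvu)] at this
      · have := mergeDecide_exhausted (w := w) (kb := kb) (k := k) (by omega) e2 e23 e24 e25
          (fun h => hbp h.2)
        rwa [if_pos hb] at this
    have hM := mergeMove_source (kb := kb) (r := update r₁ 25 1) (k := k) (by omega)
      (hr₁.update (by omega)) (src := src) (b := b) (c := dst + p) (by simp [e19]) (by simp [e23])
      (by simp) (by simp [e27]) (by simp [e28]) hb hu hk (by omega) (by omega) hkb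
    -- The placed key is compared with its own original, so the comparison yields `1` and cancels
    -- the flag.
    have hU := mergeUndecide_keys (kb := kb) (r := update (update r₁ 25 1) 23 (b - 1))
      (k := update k (dst + p) (some u)) (by omega)
      ((hr₁.update (by omega)).update (by omega)) (src := src) (b := b - 1) (lb := lb)
      (c := dst + p) (u := u) (v := u) (by simp [e18]) (by simp [e19]) (by simp) (by simp [e27])
      (by simp [e28]) (by omega)
      (by rw [← Nat.add_sub_assoc hb, Function.update_of_ne hne, hu]) (by simp) (by simp)
      (by omega) (by omega) hkb
    exact (hD.seq (hM.seq hU)).congr (update_comm_self (by decide) e25 _) rfl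

/-- By `hu'` the source key merged last exceeds `v`, so the clearing comparison yields `0`, in
agreement with the flag. `hne` keeps that source key out of the two exchanged cells. -/
theorem mergeStep_target (hw : 2 ≤ w) {r : Regs} {k : Keys d} (hr : Fits w r)
    {src dst lb tot x b p : ℕ} (h : MergeRegs r src dst lb tot x b) (hp : tot = x + p + 1)
    (hbp : b ≤ p) (hlb : b ≤ lb) {v : Fin (2 ^ d)} (hv : k (dst + p - b) = some v)
    (hu : 1 ≤ b → ∃ u, k (src + b - 1) = some u ∧ u ≤ v)
    (hu' : b < lb → ∃ u, k (src + b) = some u ∧ v < u)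
    (hne : b < lb → src + b ≠ dst + p ∧ src + b ≠ dst + p - b)
    (hs : src + lb ≤ kb) (hd : dst + tot ≤ kb) (hkb : kb < 2 ^ w) :
    Exec w kb mergeStep r k r
      (update (update k (dst + p - b) (k (dst + p))) (dst + p) (some v)) 0 27 := by
  obtain ⟨h2, h18, h19, h20, h21, h22, h23, h24, h25, h26, h27, h28⟩ := h
  refine Exec.wthBlock_self (lo := 0) (hi := 21) (by omega) hr ?_ ?_
  · simp [RegOK, BinOp.eval, h24, h28, h21, h22, h20]
    omega
  · set l : List Instr := [.add 24 .sub 21 22, .subC 24 1, .add 28 .add 20 24] with hl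
    have hr₁ : Fits w (regEval l r) := by
      refine RegOK.fits ?_ hr
      simp [hl, RegOK, BinOp.eval, h24, h28, h21, h22, h20]
      omega
    have e24 : regEval l r 24 = p := by
      simp [hl, regEval, BinOp.eval, h24, h21, h22]; omega
    have e28 : regEval l r 28 = dst + p := by
      simp [hl, regEval, BinOp.eval, h24, h21, h22, h28, h20]; omega
    have e : ∀ y, y ≠ 24 → y ≠ 28 → regEval l r y = r y := fun y h h' => by
      simp [hl, regEval, h, h']
    generalize regEval l r = r₁ at hr₁ e24 e28 e
    have e2 := (e 2 (by decide) (by decide)).trans h2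
    have e18 := (e 18 (by decide) (by decide)).trans h18
    have e19 := (e 19 (by decide) (by decide)).trans h19
    have e23 := (e 23 (by decide) (by decide)).trans h23
    have e25 := (e 25 (by decide) (by decide)).trans h25
    have e26 := (e 26 (by decide) (by decide)).trans h26
    have e27 := (e 27 (by decide) (by decide)).trans h27
    have hD : Exec w kb mergeDecide r₁ k (update r₁ 25 0) k 0 10 := by
      by_cases hb : 1 ≤ b
      · obtain ⟨u, hu, huv⟩ := hu hb
        have := mergeDecide_keys hw hr₁ e2 e19 e23 e24 e25 e26 e27 e28 hb hbp hu hv (by omega)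
          (by omega) hkb
        rwa [if_pos huv] at this
      · have := mergeDecide_exhausted (w := w) (kb := kb) (k := k) (by omega) e2 e23 e24 e25
          (fun h => hb h.1)
        rwa [if_neg hb] at this
    have e0 : update r₁ 25 0 = r₁ := by rw [← e25, Function.update_eq_self]
    rw [e0] at hD
    have hM := mergeMove_target (kb := kb) (r := r₁) (k := k) (by omega) hr₁ e23 e25 e26 e28 hv
      (by omega) hkb
    refine hD.seq (hM.seq (hi₂ := 5) (lo₂ := 0) ?_)
    by_cases hb : b < lb
    · obtain ⟨u, hu, hvu⟩ := hu' hb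
      have := mergeUndecide_keys (kb := kb) (r := r₁)
        (k := update (update k (dst + p - b) (k (dst + p))) (dst + p) (some v)) (by omega) hr₁
        e18 e19 e23 e27 e28 hb (u := u) (v := v)
        (by rw [Function.update_of_ne (hne hb).1, Function.update_of_ne (hne hb).2, hu]) (by simp)
        (by rw [e25, if_neg (not_le.2 hvu)]) (by omega) (by omega) hkb
      rwa [e0] at this
    · exact mergeUndecide_skip e18 e23 (by omega)

/-! ### Sorted lists -/

/-- The sorted list with the same elements. -/
def srt (l : List (Fin (2 ^ d))) : List (Fin (2 ^ d)) := l.insertionSort (· ≤ ·)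

theorem srt_perm (l : List (Fin (2 ^ d))) : (srt l).Perm l := List.perm_insertionSort _ _

theorem srt_pairwise (l : List (Fin (2 ^ d))) : (srt l).Pairwise (· ≤ ·) :=
  List.pairwise_insertionSort _ _

@[simp] theorem length_srt (l : List (Fin (2 ^ d))) : (srt l).length = l.length :=
  List.length_insertionSort _ _

@[simp] theorem srt_nil : srt ([] : List (Fin (2 ^ d))) = [] := rfl

theorem eq_srt {l l' : List (Fin (2 ^ d))} (h : l.Perm l') (hl : l.Pairwise (· ≤ ·)) :
    l = srt l' :=
  (h.trans (srt_perm l').symm).eq_of_pairwise' hl (srt_pairwise l')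

theorem srt_congr {l l' : List (Fin (2 ^ d))} (h : l.Perm l') : srt l = srt l' :=
  eq_srt ((srt_perm l).trans h) (srt_pairwise l)

theorem srt_eq_append_singleton {l l' : List (Fin (2 ^ d))} {x : Fin (2 ^ d)}
    (hl : l.Perm (l' ++ [x])) (h : ∀ y ∈ l', y ≤ x) : srt l = srt l' ++ [x] := by
  refine (eq_srt (((srt_perm l').append_right [x]).trans hl.symm) ?_).symm
  rw [List.pairwise_append]
  refine ⟨srt_pairwise _, List.pairwise_singleton _ _, fun y hy z hz => ?_⟩
  rw [List.mem_singleton.1 hz]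
  exact h y ((srt_perm l').mem_iff.1 hy)

/-- Removing the maximum from the sorted union of two prefixes. -/
theorem take_of_srt_eq_append {Z l l' : List (Fin (2 ^ d))} {x : Fin (2 ^ d)} {c : ℕ}
    (hZ : srt l = Z.take (c + 1)) (hl : l.Perm (l' ++ [x])) (hc : l'.length = c)
    (h : ∀ y ∈ l', y ≤ x) : srt l' = Z.take c ∧ Z[c]? = some x := by
  rw [srt_eq_append_singleton hl h] at hZ
  have h1 := congrArg (List.take c) hZ
  have h2 := congrArg (fun l => l[c]?) hZ
  simp only [List.take_take] at h1
  rw [List.take_append_of_le_length (by simp [hc]), List.take_of_length_le (by simp [hc])] at h1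
  refine ⟨by simpa using h1, ?_⟩
  simp only [List.getElem?_append_right (show (srt l').length ≤ c by simp [hc])] at h2
  simp [hc] at h2
  exact h2.symm

theorem le_of_mem_take {l : List (Fin (2 ^ d))} (hl : l.Pairwise (· ≤ ·)) {a : ℕ}
    {x : Fin (2 ^ d)} (hx : l[a]? = some x) {y : Fin (2 ^ d)} (hy : y ∈ l.take (a + 1)) :
    y ≤ x := by
  obtain ⟨h, rfl⟩ := List.getElem?_eq_some_iff.1 hx
  obtain ⟨i, hi, rfl⟩ := List.mem_take_iff_getElem.1 hy
  rcases Nat.lt_or_ge i a with hia | hia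
  · exact List.pairwise_iff_getElem.1 hl _ _ _ _ hia
  · obtain rfl : i = a := by omega
    exact le_rfl

/-! ### Correctness of merging -/

/-- Put the list `Z` into the cells from `dst` on. -/
def overlay (k : Keys d) (dst : ℕ) (Z : List (Fin (2 ^ d))) : Keys d :=
  fun y => if dst ≤ y ∧ y < dst + Z.length then Z[y - dst]? else k y

/-- The target during merging, when the first `a` of its keys and `b` keys of the source are
still to be processed. -/
def mergeKeys (k : Keys d) (dst tot : ℕ) (M Z : List (Fin (2 ^ d))) (a b : ℕ) : Keys d :=
  fun y => if dst ≤ y ∧ y < dst + tot then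
    if y < dst + a then M[y - dst]? else if y < dst + a + b then none else Z[y - dst]?
  else k y

/-- A source key fills the right end of the gap and shortens it by one cell; a target key
(`mergeKeys_target`) shifts the gap to the left without changing its length. -/
theorem mergeKeys_source {k : Keys d} {dst tot : ℕ} {M Z : List (Fin (2 ^ d))} {a b : ℕ}
    {u : Fin (2 ^ d)} (hab : a + b < tot) (hZ : Z[a + b]? = some u) :
    update (mergeKeys k dst tot M Z a (b + 1)) (dst + (a + b)) (some u) =
      mergeKeys k dst tot M Z a b := by
  funext y
  by_cases hy : y = dst + (a + b)
  · subst hy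
    rw [Function.update_self, mergeKeys, if_pos (by omega), if_neg (by omega), if_neg (by omega),
      show dst + (a + b) - dst = a + b by omega, hZ]
  · rw [Function.update_of_ne hy]
    simp only [mergeKeys]
    split_ifs <;> first | rfl | omega

theorem mergeKeys_target {k : Keys d} {dst tot : ℕ} {M Z : List (Fin (2 ^ d))} {a b : ℕ}
    {v : Fin (2 ^ d)} (hab : a + b < tot) (hZ : Z[a + b]? = some v) :
    update (update (mergeKeys k dst tot M Z (a + 1) b) (dst + (a + b) - b)
      (mergeKeys k dst tot M Z (a + 1) b (dst + (a + b)))) (dst + (a + b)) (some v) =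
      mergeKeys k dst tot M Z a b := by
  funext y
  by_cases hy : y = dst + (a + b)
  · subst hy
    rw [Function.update_self, mergeKeys, if_pos (by omega), if_neg (by omega), if_neg (by omega),
      show dst + (a + b) - dst = a + b by omega, hZ]
  · rw [Function.update_of_ne hy]
    by_cases hy' : y = dst + (a + b) - b
    · subst hy'
      rw [Function.update_self, mergeKeys, if_pos (by omega), if_neg (by omega), if_pos (by omega),
        mergeKeys, if_pos (by omega), if_neg (by omega), if_pos (by omega)]
    · rw [Function.update_of_ne hy']
      simp only [mergeKeys]
      split_ifs <;> first | rfl | omega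

/-- The unprocessed keys always form an initial part of the sorted result, so the larger of the two
last ones belongs in the last free cell. The lower time bound counts one loop test per filled cell.
-/
theorem mergeInto_exec (hw : 2 ≤ w) {r : Regs} {k : Keys d} (hr : Fits w r)
    {src dst tot : ℕ} {M T : List (Fin (2 ^ d))} (h : MergeRegs r src dst T.length tot 0 0)
    (htot : tot = M.length + T.length)
    (hMs : M.Pairwise (· ≤ ·)) (hTs : T.Pairwise (· ≤ ·))
    (hT : ∀ p < T.length, k (src + p) = T[p]?) (hM : ∀ p < tot, k (dst + p) = M[p]?)
    (hdis : ∀ p < T.length, ∀ q < tot, src + p ≠ dst + q)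
    (hs : src + T.length ≤ kb) (hd : dst + tot ≤ kb) (hkb : kb < 2 ^ w) :
    Exec w kb mergeInto r k r (overlay k dst (srt (M ++ T))) tot (30 * tot + 4) := by
  set Z := srt (M ++ T) with hZ
  have hZl : Z.length = tot := by simp [hZ, htot]
  have h1 : Exec w kb (.instr (.add 23 .left 18 18)) r k (update r 23 T.length) k 1 1 :=
    (Exec.add (by decide) (by decide) (by simp [BinOp.eval, h.h23, h.h18]; omega)).congr
      (by simp [BinOp.eval, h.h23, h.h18]) rfl
  have h2 := Exec.forLoop (w := w) (kb := kb) (d := d) (x := 22) (y := 21) (Q := mergeStep)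
    (by decide) tot (by omega)
    -- The clause with `v < u` says that every remaining target key lies strictly below the source
    -- key merged last; it is what makes the flag clearable.
    (fun x r' k' => ∃ a b, r' = update r 23 b ∧ a + b + x = tot ∧ a ≤ M.length ∧ b ≤ T.length ∧
      srt (M.take a ++ T.take b) = Z.take (a + b) ∧
      (∀ u, T[b]? = some u → ∀ v ∈ M.take a, v < u) ∧ k' = mergeKeys k dst tot M Z a b)
    (fun _ => 0) 27
    (by
      rintro i r' k' ⟨a, b, rfl, -⟩
      simp [h.h22, h.h21])
    (by
      rintro x hx r' k' ⟨a, b, rfl, hab, ha, hb, hsrt, hlt, rfl⟩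
      have hregs : MergeRegs (update (update r 23 b) 22 x) src dst T.length tot x b := by
        obtain ⟨h2, h18, h19, h20, h21, h22, h23, h24, h25, h26, h27, h28⟩ := h
        constructor <;> simp [*]
      have hfit : Fits w (update (update r 23 b) 22 x) := (hr.update (by omega)).update (by omega)
      have hsrc : ∀ p < T.length, mergeKeys k dst tot M Z a b (src + p) = T[p]? := fun p hp => by
        have := hdis p hp (src + p - dst)
        rw [mergeKeys, if_neg (by omega), hT p hp]
      have hdst : ∀ p < a, mergeKeys k dst tot M Z a b (dst + p) = M[p]? := fun p hp => by
        rw [mergeKeys, if_pos (by omega), if_pos (by omega), Nat.add_sub_cancel_left]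
      -- the step takes a key of the source
      have hsource : ∀ b' u, b = b' + 1 → T[b']? = some u → (∀ v ∈ M.take a, v < u) →
          ∃ r' k', Exec w kb mergeStep (update (update r 23 b) 22 x) (mergeKeys k dst tot M Z a b)
            (update r' 22 x) k' 0 27 ∧ ∃ a b, r' = update r 23 b ∧ a + b + (x + 1) = tot ∧
              a ≤ M.length ∧ b ≤ T.length ∧ srt (M.take a ++ T.take b) = Z.take (a + b) ∧
              (∀ u, T[b]? = some u → ∀ v ∈ M.take a, v < u) ∧
              k' = mergeKeys k dst tot M Z a b := by
        rintro b' u rfl hu hv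
        have htk : T.take (b' + 1) = T.take b' ++ [u] := by
          rw [List.take_add_one, hu]; rfl
        obtain ⟨e1, e2⟩ := take_of_srt_eq_append (c := a + b') (l' := M.take a ++ T.take b')
          (x := u) hsrt (by rw [htk, List.append_assoc]) (by simp; omega) (by
            intro y hy
            rcases List.mem_append.1 hy with hy | hy
            · exact (hv y hy).le
            · exact le_of_mem_take hTs hu (by rw [htk]; exact List.mem_append_left _ hy))
        have hstep := mergeStep_source hw hfit hregs (p := a + b') (by omega) (by omega) hb
          (u := u) (k := mergeKeys k dst tot M Z a (b' + 1)) (by rw [← hu, ← hsrc b' (by omega)]; rfl)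
          (by rw [mergeKeys, if_pos (by omega), if_neg (by omega), if_pos (by omega)])
          (fun hap => by
            refine ⟨M[a - 1], ?_, hv _ ?_⟩
            · rw [show dst + (a + b') - (b' + 1) = dst + (a - 1) by omega, hdst _ (by omega)]
              simp
            · exact List.mem_take_iff_getElem.2 ⟨a - 1, by omega, rfl⟩)
          hs hd hkb
        rw [mergeKeys_source (by omega) e2] at hstep
        refine ⟨update r 23 b', _, hstep.congr ?_ rfl, a, b', rfl, by omega, ha, by omega, e1, ?_,
          rfl⟩
        · rw [Function.update_comm (by decide), Function.update_idem]; rfl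
        · intro u' hu'
          rw [hu] at hu'
          cases hu'
          exact hv
      -- the step moves a key of the target
      have htarget : ∀ a' v, a = a' + 1 → M[a']? = some v → (∀ u ∈ T.take b, u ≤ v) →
          ∃ r' k', Exec w kb mergeStep (update (update r 23 b) 22 x) (mergeKeys k dst tot M Z a b)
            (update r' 22 x) k' 0 27 ∧ ∃ a b, r' = update r 23 b ∧ a + b + (x + 1) = tot ∧
              a ≤ M.length ∧ b ≤ T.length ∧ srt (M.take a ++ T.take b) = Z.take (a + b) ∧
              (∀ u, T[b]? = some u → ∀ v ∈ M.take a, v < u) ∧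
              k' = mergeKeys k dst tot M Z a b := by
        rintro a' v rfl hv hu
        have htk : M.take (a' + 1) = M.take a' ++ [v] := by
          rw [List.take_add_one, hv]; rfl
        obtain ⟨e1, e2⟩ := take_of_srt_eq_append (c := a' + b) (l' := M.take a' ++ T.take b)
          (x := v) (by rw [hsrt]; congr 1; omega)
          (by
            rw [htk, List.append_assoc, List.append_assoc]
            exact List.perm_append_comm.append_left _) (by simp; omega) (by
            intro y hy
            rcases List.mem_append.1 hy with hy | hy
            · exact le_of_mem_take hMs hv (by rw [htk]; exact List.mem_append_left _ hy)
            · exact hu y hy)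
        have hstep := mergeStep_target hw hfit hregs (p := a' + b) (by omega) (by omega) hb
          (v := v) (k := mergeKeys k dst tot M Z (a' + 1) b)
          (by rw [← hv, ← hdst a' (by omega)]; congr 1; omega)
          (fun hb1 => by
            refine ⟨T[b - 1], ?_, hu _ ?_⟩
            · rw [Nat.add_sub_assoc hb1, hsrc _ (by omega)]
              simp
            · exact List.mem_take_iff_getElem.2 ⟨b - 1, by omega, rfl⟩)
          (fun hb1 => ⟨T[b], by rw [hsrc _ hb1]; simp, hlt _ (by simp) _ (by simp [htk])⟩)
          (fun hb1 => by
            have h1 := hdis b hb1 (a' + b) (by omega)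
            have h2 := hdis b hb1 a' (by omega)
            omega)
          hs hd hkb
        rw [mergeKeys_target (by omega) e2] at hstep
        refine ⟨update r 23 b, _, hstep, a', b, rfl, by omega, by omega, hb, e1, ?_, rfl⟩
        exact fun u hu v hv => hlt u hu v (by rw [htk]; exact List.mem_append_left _ hv)
      rcases Nat.eq_zero_or_pos b with rfl | hb0
      · have ha0 : a - 1 < M.length := by omega
        exact htarget (a - 1) M[a - 1] (by omega) (by simp) (by simp)
      · have hbT : b - 1 < T.length := by omega
        rcases Nat.eq_zero_or_pos a with rfl | ha0
        · exact hsource (b - 1) T[b - 1] (by omega) (by simp) (by simp)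
        · have haM : a - 1 < M.length := by omega
          -- A tie goes to the target; the negation is then strict and renews the strict clause of
          -- the invariant.
          by_cases hle : T[b - 1] ≤ M[a - 1]
          · refine htarget (a - 1) M[a - 1] (by omega) (by simp) fun u hu => ?_
            refine le_trans (le_of_mem_take hTs (a := b - 1) (x := T[b - 1]) (by simp) ?_) hle
            rwa [Nat.sub_add_cancel hb0]
          · refine hsource (b - 1) T[b - 1] (by omega) (by simp) fun v hv => ?_
            refine lt_of_le_of_lt (le_of_mem_take hMs (a := a - 1) (x := M[a - 1]) (by simp) ?_)
              (not_le.1 hle)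
            rwa [Nat.sub_add_cancel ha0])
    (r := update r 23 T.length) (k := k)
    ⟨M.length, T.length, rfl, by omega, le_rfl, le_rfl, by simp [hZ, List.take_of_length_le],
      by simp, by
      funext y
      simp only [mergeKeys]
      split_ifs with h1 h2 h3
      · rw [← hM _ (by omega)]; congr 1; omega
      · obtain ⟨q, rfl⟩ := Nat.exists_eq_add_of_le h1.1
        rw [hM q (by omega)]; simp; omega
      · omega
      · rfl⟩
  obtain ⟨r', k', h2, a, b, rfl, hab, -, -, -, -, rfl⟩ := h2
  obtain ⟨rfl, rfl⟩ : a = 0 ∧ b = 0 := by omega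
  refine ((h1.seq h2).mono (by simp) (by omega)).congr ?_ ?_
  · rw [← h.h23, Function.update_eq_self]
  · funext y
    simp only [mergeKeys, overlay, hZl]
    split_ifs <;> first | rfl | omega

/-! ### Bottom-up merge sort of a block, keeping all levels

Registers: `2` holds `1`, `3` the number of levels, `5` the distance of the levels, `8` the address
of the block, `9` its length, and `10` the address of the working storage.  The level is in `11`,
its address in `12`, that of the next level in `13`, the length of its runs in `14`, their number
in `15`; `16` is the index of a run (or of a key to be copied) and `17` the offset of the run. -/

/-- Copy the block into the lowest level. -/
def copyBlock : Prog :=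
  forLoop 16 9 (wth (block [.add 26 .add 8 16, .add 27 .add 10 16]) (.instr (.keyCopy 26 27)))

/-- Parameters for merging a run into the next level. -/
def runParams : List Instr :=
  [.add 17 .mul 16 14, .add 26 .sub 9 17, .add 27 .sub 14 26, .add 18 .sub 14 27,
    .sub 27 .sub 14 26, .sub 26 .sub 9 17, .add 19 .add 12 17, .add 27 .land 16 2,
    .add 26 .mul 27 14, .add 20 .add 13 17, .sub 20 .left 26 26, .add 21 .add 26 18,
    .sub 26 .mul 27 14, .sub 27 .land 16 2]

/-- Parameters of a level. -/
def levelParams : List Instr :=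
  [.add 12 .mul 11 5, .add 12 .left 10 10, .add 13 .add 12 5, .add 14 .shl 2 11,
    .add 26 .sub 9 2, .add 15 .shr 26 11, .addC 15 1, .sub 26 .sub 9 2]

/-- A run of even index meets an empty target and is merely copied; the next run is merged into this
copy. Both runs remain intact on the lower level. -/
def mergeRun : Prog := wth (block runParams) mergeInto

/-- Merge the runs of a level in pairs. -/
def mergeLevel : Prog := wth (block levelParams) (forLoop 16 15 mergeRun)

/-- Sort the block in the working storage. -/
def sortBlock : Prog := .seq copyBlock (forLoop 11 3 mergeLevel)

/-! ### Layout of the sorted runs in the levels -/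

/-- The list `X` with its segments of length `W` sorted. -/
def runCells (W : ℕ) (X : List (Fin (2 ^ d))) : Keys d :=
  fun p => (srt ((X.drop (p / W * W)).take W))[p % W]?

theorem runCells_take (W : ℕ) (X : List (Fin (2 ^ d))) (t p : ℕ) :
    runCells W (X.take t) p =
      (srt ((X.drop (p / W * W)).take (min W (t - p / W * W))))[p % W]? := by
  rw [runCells, List.drop_take, List.take_take]

theorem runCells_none {W : ℕ} {X : List (Fin (2 ^ d))} {p : ℕ} (hp : X.length ≤ p) :
    runCells W X p = none := by
  have := Nat.div_add_mod' p W
  rw [runCells, List.getElem?_eq_none]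
  simp
  omega

theorem runCells_nil (W p : ℕ) : runCells W ([] : List (Fin (2 ^ d))) p = none :=
  runCells_none (Nat.zero_le _)

theorem runCells_one (X : List (Fin (2 ^ d))) (p : ℕ) : runCells 1 X p = X[p]? := by
  rw [runCells, Nat.div_one, Nat.mul_one, Nat.mod_one]
  rcases hX : X.drop p with _ | ⟨x, l⟩
  · rw [List.getElem?_eq_none (List.drop_eq_nil_iff.1 hX)]; rfl
  · have : X[p]? = some x := by
      rw [← Nat.add_zero p, ← List.getElem?_drop, hX]; rfl
    rw [this]; rfl

theorem runCells_add {W : ℕ} (X : List (Fin (2 ^ d))) (i : ℕ) {p : ℕ} (hp : p < W) :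
    runCells W X (i * W + p) = (srt ((X.drop (i * W)).take W))[p]? := by
  rw [runCells, Nat.add_comm, Nat.add_mul_div_right _ _ (by omega), Nat.add_mul_mod_self_right,
    Nat.mod_eq_of_lt hp, Nat.div_eq_of_lt hp, Nat.zero_add]

/-- The keys during the sorting of the list `X` in the cells from `base` on: the levels up to `l`
are complete, and the next one contains the sorted runs of the first `t` elements. -/
def sortKeys (k : Keys d) (base B : ℕ) (X : List (Fin (2 ^ d))) (l t : ℕ) : Keys d := fun y =>
  if y < base then k y else
    runCells (2 ^ ((y - base) / B)) (if (y - base) / B ≤ l then X else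
      if (y - base) / B = l + 1 then X.take t else []) ((y - base) % B)

theorem sortKeys_at (k : Keys d) (base : ℕ) {B : ℕ} (X : List (Fin (2 ^ d))) (l t i : ℕ) {p : ℕ}
    (hp : p < B) : sortKeys k base B X l t (base + i * B + p) =
      runCells (2 ^ i) (if i ≤ l then X else if i = l + 1 then X.take t else []) p := by
  have h1 : (base + i * B + p - base) / B = i := by
    rw [Nat.add_assoc, Nat.add_sub_cancel_left, Nat.add_comm, Nat.add_mul_div_right _ _ (by omega),
      Nat.div_eq_of_lt hp, Nat.zero_add]
  have h2 : (base + i * B + p - base) % B = p := by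
    rw [Nat.add_assoc, Nat.add_sub_cancel_left, Nat.add_comm, Nat.add_mul_mod_self_right,
      Nat.mod_eq_of_lt hp]
  rw [sortKeys, if_neg (by omega), h1, h2]

theorem sortKeys_succ (k : Keys d) (base B : ℕ) (X : List (Fin (2 ^ d))) (l : ℕ) :
    sortKeys k base B X l X.length = sortKeys k base B X (l + 1) 0 := by
  funext y
  simp only [sortKeys, List.take_length, List.take_zero, ite_self]
  split_ifs <;> first | rfl | omega

theorem exists_cell {base B y : ℕ} (hB : 0 < B) (hy : base ≤ y) :
    ∃ i p, p < B ∧ y = base + i * B + p :=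
  ⟨(y - base) / B, (y - base) % B, Nat.mod_lt _ hB, by
    have := Nat.div_add_mod' (y - base) B
    omega⟩

/-- Runs of level `0` have length `1`, so the unsorted copy is already a complete level. -/
theorem overlay_eq_sortKeys {k : Keys d} {base B : ℕ} (hB : 0 < B) {X : List (Fin (2 ^ d))}
    (hX : X.length ≤ B) (hk : ∀ y, base ≤ y → k y = none) :
    overlay k base X = sortKeys k base B X 0 0 := by
  funext y
  by_cases hy : y < base
  · rw [overlay, if_neg (by omega), sortKeys, if_pos hy]
  · obtain ⟨i, p, hp, rfl⟩ := exists_cell hB (not_lt.1 hy)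
    rw [sortKeys_at _ _ _ _ _ _ hp, overlay]
    rcases Nat.eq_zero_or_pos i with rfl | hi
    · rw [if_pos le_rfl, pow_zero, runCells_one, hk _ (not_lt.1 hy)]
      split_ifs with h
      · congr 1; omega
      · rw [List.getElem?_eq_none (by omega)]
    · have : 1 * B ≤ i * B := Nat.mul_le_mul_right _ hi
      rw [if_neg (by omega), if_neg (by omega), hk _ (by omega), List.take_zero, ite_self,
        runCells_nil]

/-- Merging the `j`-th run of length `W = 2 ^ l` advances the next level. -/
theorem overlay_sortKeys {k : Keys d} {base B l j : ℕ} (hB : 0 < B) {X : List (Fin (2 ^ d))}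
    (hX : X.length ≤ B) (hj : j * 2 ^ l ≤ X.length) :
    overlay (sortKeys k base B X l (j * 2 ^ l))
      (base + (l + 1) * B + (j * 2 ^ l - j % 2 * 2 ^ l))
      (srt (srt ((X.drop (j * 2 ^ l - j % 2 * 2 ^ l)).take (j % 2 * 2 ^ l)) ++
        srt ((X.drop (j * 2 ^ l)).take (2 ^ l)))) =
      sortKeys k base B X l (min ((j + 1) * 2 ^ l) X.length) := by
  set W := 2 ^ l with hW
  have hWpos : 0 < W := Nat.two_pow_pos l
  have hW2 : 2 ^ (l + 1) = 2 * W := by rw [pow_succ, Nat.mul_comm]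
  obtain ⟨c, hc, ha⟩ : ∃ c, c = j / 2 * (2 * W) ∧ j * W = c + j % 2 * W := by
    refine ⟨_, rfl, ?_⟩
    conv_lhs => rw [← Nat.div_add_mod' j 2]
    ring
  have haW : j % 2 * W ≤ W := by
    have : j % 2 ≤ 1 := by omega
    calc j % 2 * W ≤ 1 * W := Nat.mul_le_mul_right _ this
      _ = W := one_mul _
  rw [show j * W - j % 2 * W = c by omega, Nat.succ_mul j W]
  generalize j % 2 * W = a at *
  generalize j * W = o at *
  have hl : srt (srt ((X.drop c).take a) ++ srt ((X.drop o).take W)) =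
      srt ((X.drop c).take (a + W)) := by
    rw [List.take_add, List.drop_drop, ← ha]
    exact srt_congr ((srt_perm _).append (srt_perm _))
  rw [hl]
  have hlen : (srt ((X.drop c).take (a + W))).length = min (o + W) X.length - c := by
    simp; omega
  funext y
  simp only [overlay, hlen]
  split_ifs with hy
  · obtain ⟨p, rfl⟩ := Nat.exists_eq_add_of_le hy.1
    rw [Nat.add_sub_cancel_left, Nat.add_assoc _ c p, sortKeys_at _ _ _ _ _ _ (by omega),
      if_neg (by omega), if_pos rfl, hW2, hc, runCells_add _ _ (by omega), ← hc, List.drop_take,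
      List.take_take, List.take_eq_take_iff.2]
    simp only [List.length_drop]
    omega
  · by_cases hyb : y < base
    · rw [sortKeys, sortKeys, if_pos hyb, if_pos hyb]
    obtain ⟨i, p, hp, rfl⟩ := exists_cell hB (not_lt.1 hyb)
    rw [sortKeys_at _ _ _ _ _ _ hp, sortKeys_at _ _ _ _ _ _ hp]
    split_ifs with h1 h2
    · rfl
    · subst h2
      -- Cells before `c` belong to complete runs, which lie within both prefixes; the other cells
      -- lie beyond both prefixes and are empty.
      rcases Nat.lt_or_ge p c with hpc | hpc
      · have h3 : p / (2 * W) < j / 2 := Nat.div_lt_of_lt_mul (by rw [Nat.mul_comm]; omega)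
        have h4 : (p / (2 * W) + 1) * (2 * W) ≤ c := hc ▸ Nat.mul_le_mul_right _ h3
        rw [Nat.succ_mul] at h4
        rw [hW2, runCells_take, runCells_take, Nat.min_eq_left (by omega),
          Nat.min_eq_left (by omega)]
      · rw [runCells_none, runCells_none] <;> simp <;> omega
    · rfl

/-! ### Executing the block sort -/

/-- The registers during the sorting of a block of length `len`. -/
structure SortRegs (r : Regs) (e B off len base : ℕ) : Prop where
  h2 : r 2 = 1
  h3 : r 3 = e
  h5 : r 5 = B
  h8 : r 8 = off
  h9 : r 9 = len
  h10 : r 10 = base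
  hz : ∀ y, 11 ≤ y → r y = 0

theorem copyBlock_exec (hw : 1 ≤ w) {r : Regs} {k : Keys d} (hr : Fits w r)
    {e B off base : ℕ} {X : List (Fin (2 ^ d))} (h : SortRegs r e B off X.length base)
    (hX : ∀ p < X.length, k (off + p) = X[p]?) (hk : ∀ y, base ≤ y → k y = none)
    (hoff : off + X.length ≤ base) (hkb : base + X.length ≤ kb) (hkw : kb < 2 ^ w) :
    Exec w kb copyBlock r k r (overlay k base X) 0 (8 * X.length + 3) := by
  obtain ⟨r', k', hE, rfl, rfl⟩ := Exec.forLoop (w := w) (kb := kb) (x := 16) (y := 9)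
    (Q := wth (block [.add 26 .add 8 16, .add 27 .add 10 16]) (.instr (.keyCopy 26 27)))
    (r := r) (k := k) (by decide) X.length (by omega)
    (fun i r' k' => r' = r ∧ k' = overlay k base (X.take i)) (fun _ => 0) 5
    (by rintro i r' k' ⟨rfl, -⟩; exact ⟨h.hz _ (by omega), h.h9⟩)
    (by
      rintro i hi r' k' ⟨rfl, rfl⟩
      refine ⟨r', _, ?_, rfl, rfl⟩
      refine (Exec.wthBlock_self (lo := 1) (hi := 1) hw (hr.update (by omega)) ?_ ?_).mono
        (by omega) le_rfl
      · simp [RegOK, BinOp.eval, h.h8, h.h10, h.hz]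
        omega
      · set r₁ := regEval _ (update r' 16 i)
        have e26 : r₁ 26 = off + i := by simp [r₁, regEval, BinOp.eval, h.h8, h.hz]
        have e27 : r₁ 27 = base + i := by simp [r₁, regEval, BinOp.eval, h.h10, h.hz]
        refine (Exec.keyCopy (u := X[i]) ?_ ?_ ?_ ?_).congr rfl ?_
        · rw [e26, overlay, if_neg (by omega), hX i hi]; simp
        · rw [e27, overlay, if_neg (by simp), hk _ (by omega)]
        · omega
        · omega
        · rw [e27]
          funext y
          by_cases hy : y = base + i
          · subst hy
            rw [Function.update_self, overlay, if_pos (by simp; omega), Nat.add_sub_cancel_left]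
            simp
          · rw [Function.update_of_ne hy]
            simp only [overlay, List.length_take]
            split_ifs with h1 h2 h2
            · rw [List.getElem?_take_of_lt (by omega), List.getElem?_take_of_lt (by omega)]
            · omega
            · omega
            · rfl)
    ⟨rfl, by funext y; simp [overlay]⟩
  rw [List.take_length] at hE
  exact hE.mono (Nat.zero_le _) (by omega)

/-- The registers during the processing of a level. -/
structure LevelRegs (r : Regs) (len W src dst j : ℕ) : Prop where
  h2 : r 2 = 1
  h9 : r 9 = len
  h12 : r 12 = src
  h13 : r 13 = dst
  h14 : r 14 = W
  h16 : r 16 = j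
  hz : ∀ y, 17 ≤ y → r y = 0

/-- With truncated subtraction, `W - (W - m) = min W m`; and `j &&& 1` is the parity of `j`. The
scratch registers `26` and `27` are cleared within the block by subtracting the same values again.
-/
theorem runParams_steps (hw : 1 ≤ w) {r : Regs} {len W src dst j : ℕ} (h : LevelRegs r len W src dst j)
    (hW : W < 2 ^ w) (hsrc : src + len < 2 ^ w) (hdst : dst + len < 2 ^ w)
    (hj : j * W ≤ len) :
    ∃ r', RegSteps w runParams r r' ∧
      MergeRegs r' (src + j * W) (dst + (j * W - j % 2 * W))
        (min W (len - j * W)) (j % 2 * W + min W (len - j * W)) 0 0 := by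
  obtain ⟨h2, h9, h12, h13, h14, h16, hz⟩ := h
  have hjW : j % 2 * W ≤ j * W := Nat.mul_le_mul_right _ (Nat.mod_le _ _)
  have hj2 : j % 2 < 2 ^ w :=
    (Nat.mod_lt _ (by norm_num)).trans_le
      (calc 2 = 2 ^ 1 := rfl
        _ ≤ 2 ^ w := Nat.pow_le_pow_right (by norm_num) hw)
  have hz17 := hz 17 (by omega)
  have hz18 := hz 18 (by omega)
  have hz19 := hz 19 (by omega)
  have hz20 := hz 20 (by omega)
  have hz21 := hz 21 (by omega)
  have hz26 := hz 26 (by omega)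
  have hz27 := hz 27 (by omega)
  refine ⟨_, RegSteps.add (j * W) (by simp [BinOp.eval, *]) (by omega) (by decide) (by decide) <|
    RegSteps.add (len - j * W) (by simp [BinOp.eval, *]) (by omega) (by decide) (by decide) <|
    RegSteps.add (W - (len - j * W)) (by simp [BinOp.eval, *]) (by omega)
      (by decide) (by decide) <|
    RegSteps.add (min W (len - j * W)) (by simp [BinOp.eval, *]; omega) (by omega)
      (by decide) (by decide) <|
    RegSteps.sub 0 (by simp [BinOp.eval, *]) (by decide) (by decide) <|
    RegSteps.sub 0 (by simp [BinOp.eval, *]) (by decide) (by decide) <|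
    RegSteps.add (src + j * W) (by simp [BinOp.eval, *]) (by omega) (by decide) (by decide) <|
    RegSteps.add (j % 2) (by simp [BinOp.eval, Nat.and_one_is_mod, *]) hj2
      (by decide) (by decide) <|
    RegSteps.add (j % 2 * W) (by simp [BinOp.eval, *]) (by omega) (by decide) (by decide) <|
    RegSteps.add (dst + j * W) (by simp [BinOp.eval, *]) (by omega) (by decide) (by decide) <|
    RegSteps.sub (dst + (j * W - j % 2 * W)) (by simp [BinOp.eval]; omega)
      (by decide) (by decide) <|
    RegSteps.add (j % 2 * W + min W (len - j * W)) (by simp [BinOp.eval, *]) (by omega)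
      (by decide) (by decide) <|
    RegSteps.sub 0 (by simp [BinOp.eval, *]) (by decide) (by decide) <|
    RegSteps.sub 0 (by simp [BinOp.eval, Nat.and_one_is_mod, *]) (by decide) (by decide) <|
    RegSteps.nil _, ?_⟩
  constructor <;> simp [h2, hz]

theorem mergeRun_exec (hw : 2 ≤ w) {r : Regs} {k : Keys d} (hr : Fits w r)
    {B base l j : ℕ} {X : List (Fin (2 ^ d))}
    (h : LevelRegs r X.length (2 ^ l) (base + l * B) (base + (l + 1) * B) j)
    (hB : 0 < B) (hX : X.length ≤ B) (hj : j * 2 ^ l ≤ X.length)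
    (hkb : base + (l + 1) * B + B ≤ kb) (hlb : 2 ^ l ≤ kb) (hkw : kb < 2 ^ w) :
    Exec w kb mergeRun r (sortKeys k base B X l (j * 2 ^ l)) r
      (sortKeys k base B X l (min ((j + 1) * 2 ^ l) X.length)) 0
      (30 * min (2 * 2 ^ l) B + 32) := by
  have hW2 : 2 ^ (l + 1) = 2 * 2 ^ l := by rw [pow_succ, Nat.mul_comm]
  have hlB : (l + 1) * B = l * B + B := Nat.succ_mul _ _
  obtain ⟨c, hc, ha⟩ : ∃ c, c = j / 2 * (2 * 2 ^ l) ∧ j * 2 ^ l = c + j % 2 * 2 ^ l := by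
    refine ⟨_, rfl, ?_⟩
    conv_lhs => rw [← Nat.div_add_mod' j 2]
    ring
  have hc' : j * 2 ^ l - j % 2 * 2 ^ l = c := by omega
  have haW : j % 2 * 2 ^ l ≤ 2 ^ l := by
    have : j % 2 ≤ 1 := by omega
    calc j % 2 * 2 ^ l ≤ 1 * 2 ^ l := Nat.mul_le_mul_right _ this
      _ = 2 ^ l := one_mul _
  have hWpos : 0 < 2 ^ l := Nat.two_pow_pos l
  set T := srt ((X.drop (j * 2 ^ l)).take (2 ^ l)) with hTdef
  set M := srt ((X.drop c).take (j % 2 * 2 ^ l)) with hMdef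
  have hTl : T.length = min (2 ^ l) (X.length - j * 2 ^ l) := by simp [hTdef]
  have hMl : M.length = j % 2 * 2 ^ l := by simp [hMdef]; omega
  have hov := overlay_sortKeys (k := k) (base := base) (l := l) (j := j) hB hX hj
  rw [hc'] at hov
  have hT : ∀ p < T.length, sortKeys k base B X l (j * 2 ^ l) (base + l * B + j * 2 ^ l + p) =
      T[p]? := fun p hp => by
    rw [Nat.add_assoc _ _ p, sortKeys_at _ _ _ _ _ _ (by omega), if_pos le_rfl,
      runCells_add _ _ (by omega)]
  have hM : ∀ p < M.length + T.length,
      sortKeys k base B X l (j * 2 ^ l) (base + (l + 1) * B + c + p) = M[p]? := fun p hp => by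
    rw [Nat.add_assoc _ c p, sortKeys_at _ _ _ _ _ _ (by omega), if_neg (by omega), if_pos rfl,
      hW2, hc, runCells_add _ _ (by omega), ← hc, List.drop_take, List.take_take, hMdef,
      List.take_eq_take_iff.2]
    simp only [List.length_drop]
    omega
  obtain ⟨r', ⟨hok, rfl⟩, hregs⟩ := runParams_steps (w := w) (by omega) h (by omega) (by omega)
    (by omega) hj
  refine (Exec.wthBlock_self (lo := 0) (hi := 30 * min (2 * 2 ^ l) B + 4) (by omega) hr
    hok ?_)
  have hf := hok.fits hr
  rw [← hTl, hc', ← hMl] at hregs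
  refine ((mergeInto_exec (M := M) (T := T) hw hf hregs rfl (srt_pairwise _) (srt_pairwise _) hT hM
    ?_ ?_ ?_ hkw).congr rfl hov).mono (Nat.zero_le _) ?_
  · intro p hp q hq
    omega
  · omega
  · omega
  · have : M.length + T.length ≤ min (2 * 2 ^ l) B := by omega
    omega

/-- `W = 2 ^ l` can exceed the block length. Then there is a single run, and the cap `B` keeps the
cost of a level linear in `B`. -/
theorem runs_mul_le {B len W : ℕ} (hB : 0 < B) (hW : 0 < W) (hlen : len ≤ B) :
    ((len - 1) / W + 1) * min (2 * W) B ≤ 4 * B := by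
  rcases Nat.lt_or_ge (len - 1) W with h | h
  · rw [Nat.div_eq_of_lt h]; omega
  · have h1 : (len - 1) / W * W ≤ len - 1 := Nat.div_mul_le_self _ _
    calc ((len - 1) / W + 1) * min (2 * W) B ≤ ((len - 1) / W + 1) * (2 * W) :=
          Nat.mul_le_mul_left _ (min_le_left _ _)
      _ = 2 * ((len - 1) / W * W) + 2 * W := by ring
      _ ≤ 4 * B := by omega

/-- The number of runs is `len / 2 ^ l` rounded up, except that an empty block counts as one empty
run. -/
theorem levelParams_steps {r : Regs} {e B off len base : ℕ} (h : SortRegs r e B off len base)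
    (l : ℕ) (hB : base + l * B + B < 2 ^ w) (hlen : len + 1 < 2 ^ w) (hl : 2 ^ l < 2 ^ w) :
    ∃ r', RegSteps w levelParams (update r 11 l) r' ∧ r' 15 = (len - 1) / 2 ^ l + 1 ∧ r' 16 = 0 ∧
      ∀ j, LevelRegs (update r' 16 j) len (2 ^ l) (base + l * B) (base + (l + 1) * B) j := by
  obtain ⟨h2, h3, h5, h8, h9, h10, hz⟩ := h
  have hlB : (l + 1) * B = l * B + B := Nat.succ_mul _ _
  have hdiv : (len - 1) / 2 ^ l ≤ len - 1 := Nat.div_le_self _ _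
  have hz12 := hz 12 (by omega)
  have hz13 := hz 13 (by omega)
  have hz14 := hz 14 (by omega)
  have hz15 := hz 15 (by omega)
  have hz16 := hz 16 (by omega)
  have hz26 := hz 26 (by omega)
  refine ⟨_, RegSteps.add (l * B) (by simp [BinOp.eval, *]) (by omega) (by decide) (by decide) <|
    RegSteps.add (base + l * B) (by simp [BinOp.eval, h10]; omega) (by omega)
      (by decide) (by decide) <|
    RegSteps.add (base + (l + 1) * B) (by simp [BinOp.eval, hz13, h5]; omega) (by omega)
      (by decide) (by decide) <|
    RegSteps.add (2 ^ l) (by simp [BinOp.eval, Nat.shiftLeft_eq, h2, hz14]) hl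
      (by decide) (by decide) <|
    RegSteps.add (len - 1) (by simp [BinOp.eval, h2, h9, hz26]) (by omega)
      (by decide) (by decide) <|
    RegSteps.add ((len - 1) / 2 ^ l) (by simp [BinOp.eval, Nat.shiftRight_eq_div_pow, hz15])
      (by omega) (by decide) (by decide) <|
    RegSteps.addC ((len - 1) / 2 ^ l + 1) (by simp) (by omega) <|
    RegSteps.sub 0 (by simp [BinOp.eval, h2, h9]) (by decide) (by decide) <|
    RegSteps.nil _, by simp, by simp [hz16], fun j => ?_⟩
  constructor
  case hz =>
    intro y hy
    have : y ≠ 16 ∧ y ≠ 15 ∧ y ≠ 14 ∧ y ≠ 13 ∧ y ≠ 12 ∧ y ≠ 11 := by omega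
    by_cases h26 : y = 26
    · subst h26; simp
    · simp [this, h26, hz y (by omega)]
  all_goals simp [h2, h9]

theorem mergeLevel_exec (hw : 2 ≤ w) {r : Regs} {k : Keys d} (hr : Fits w r)
    {e B off base l : ℕ} {X : List (Fin (2 ^ d))} (h : SortRegs r e B off X.length base)
    (hB : 0 < B) (hX : X.length ≤ B)
    (hkb : base + (l + 1) * B + B ≤ kb) (hl : l ≤ kb) (hlb : 2 ^ l ≤ kb) (hkw : kb < 2 ^ w) :
    Exec w kb mergeLevel (update r 11 l) (sortKeys k base B X l 0) (update r 11 l)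
      (sortKeys k base B X (l + 1) 0) 0 (200 * B) := by
  have hlB : (l + 1) * B = l * B + B := Nat.succ_mul _ _
  have hWpos : 0 < 2 ^ l := Nat.two_pow_pos l
  have hdiv : (X.length - 1) / 2 ^ l ≤ X.length - 1 := Nat.div_le_self _ _
  obtain ⟨r₁, ⟨hok, hr₁⟩, e15, e16, hregs⟩ := levelParams_steps (w := w) h l (by omega) (by omega)
    (by omega)
  have hr' : Fits w (update r 11 l) := hr.update (by omega)
  have hf := hok.fits hr'
  rw [hr₁] at hf
  -- The `16` units are the eight instructions of `levelParams`, executed forwards and backwards.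
  refine (Exec.wthBlock_self (lo := 0) (hi := 200 * B - 16) (by omega) hr' hok ?_).mono le_rfl
    (by simp [levelParams]; omega)
  rw [hr₁]
  obtain ⟨r', k', hE, rfl, rfl⟩ := Exec.forLoop (w := w) (kb := kb) (x := 16) (y := 15)
    (Q := mergeRun) (r := r₁) (k := sortKeys k base B X l 0) (by decide)
    ((X.length - 1) / 2 ^ l + 1) (by omega)
    (fun j r' k' => r' = r₁ ∧ k' = sortKeys k base B X l (min (j * 2 ^ l) X.length))
    (fun _ => 0) (30 * min (2 * 2 ^ l) B + 32)
    (by rintro i r' k' ⟨rfl, -⟩; exact ⟨e16, e15⟩)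
    (by
      rintro j hj r' k' ⟨rfl, rfl⟩
      have hj' : j * 2 ^ l ≤ X.length := by
        have h1 : (X.length - 1) / 2 ^ l * 2 ^ l ≤ X.length - 1 := Nat.div_mul_le_self _ _
        have h2 : j * 2 ^ l ≤ (X.length - 1) / 2 ^ l * 2 ^ l :=
          Nat.mul_le_mul_right _ (by omega)
        omega
      refine ⟨r', _, ?_, rfl, rfl⟩
      rw [Nat.min_eq_left hj']
      exact mergeRun_exec hw (hf.update (by omega)) (hregs j) hB hX hj' hkb hlb hkw)
    ⟨rfl, by simp⟩
  have hfin : min (((X.length - 1) / 2 ^ l + 1) * 2 ^ l) X.length = X.length := by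
    have := Nat.lt_mul_div_succ (X.length - 1) hWpos
    rw [Nat.mul_comm] at this
    omega
  rw [hfin, sortKeys_succ] at hE
  refine hE.mono (Nat.zero_le _) ?_
  have := runs_mul_le hB hWpos hX
  generalize (X.length - 1) / 2 ^ l = q at *
  generalize min (2 * 2 ^ l) B = m at *
  have e : (q + 1) * (30 * m + 32 + 3) + 3 = 30 * ((q + 1) * m) + 35 * (q + 1) + 3 := by ring
  omega

/-- Apart from the block itself, the cells below `base` are arbitrary. Thus the lemma applies both
before and after the output has grown, which is what unsorting requires. -/
theorem sortBlock_exec (hw : 2 ≤ w) {r : Regs} {k : Keys d} (hr : Fits w r)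
    {e B off base : ℕ} {X : List (Fin (2 ^ d))} (h : SortRegs r e B off X.length base)
    (he : 0 < e) (hB : 0 < B) (hXB : X.length ≤ B)
    (hX : ∀ p < X.length, k (off + p) = X[p]?) (hk : ∀ y, base ≤ y → k y = none)
    (hoff : off + X.length ≤ base) (hkb : base + (e + 1) * B ≤ kb) (hekb : 2 ^ e ≤ kb)
    (hkw : kb < 2 ^ w) :
    Exec w kb sortBlock r k r (sortKeys k base B X e 0) 0 (220 * (e * B)) := by
  have heB : (e + 1) * B = e * B + B := Nat.succ_mul _ _
  have hB1 : 1 * B ≤ e * B := Nat.mul_le_mul_right _ he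
  have h1 := copyBlock_exec (kb := kb) (by omega) hr h hX hk hoff (by omega) hkw
  rw [overlay_eq_sortKeys hB hXB hk] at h1
  have he2 : e < 2 ^ e := Nat.lt_two_pow_self
  obtain ⟨r', k', hE, rfl, rfl⟩ := Exec.forLoop (w := w) (kb := kb) (x := 11) (y := 3)
    (Q := mergeLevel) (r := r) (k := sortKeys k base B X 0 0) (by decide) e (by omega)
    (fun l r' k' => r' = r ∧ k' = sortKeys k base B X l 0)
    (fun _ => 0) (200 * B)
    (by rintro i r' k' ⟨rfl, -⟩; exact ⟨h.hz _ (by omega), h.h3⟩)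
    (by
      rintro l hl r' k' ⟨rfl, rfl⟩
      refine ⟨r', _, mergeLevel_exec hw hr h hB hXB ?_ ?_ ?_ hkw, rfl, rfl⟩
      · have : (l + 1) * B ≤ e * B := Nat.mul_le_mul_right _ hl
        omega
      · omega
      · exact (Nat.pow_le_pow_right (by norm_num) hl.le).trans hekb)
    ⟨rfl, rfl⟩
  refine (h1.seq hE).mono (Nat.zero_le _) ?_
  nlinarith

/-! ### The sorting program

With `e` the binary length of `n`, the input is cut into `e` blocks of length at most
`B = n / e + 1`.  Each of them is sorted in the working storage from cell `2 * n` on and merged into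
the output; then its sorting is undone.  Register `3` holds `e`, register `4` the power `2 ^ e`,
register `5` the length `B`, register `7` the index of the block, and register `10` the number
`2 * n`. -/

/-- Compute the binary length of `n` and the length of the blocks. -/
def setup : Prog :=
  .seq (.instr (.addC 2 1)) <| .seq (.instr (.addC 4 1)) <|
    .seq (.loop (.eqC 3 0) .skip (block [.sub 4 .shl 2 3, .addC 3 1, .add 4 .shl 2 3]) (.lt 0 4)) <|
      block [.add 5 .div 0 3, .addC 5 1, .add 10 .add 0 0]

/-- Address and length of a block. -/
def blockParams : List Instr :=
  [.add 8 .mul 7 5, .add 26 .sub 0 8, .add 27 .sub 5 26, .add 9 .sub 5 27, .sub 27 .sub 5 26,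
    .sub 26 .sub 0 8]

/-- Parameters for merging a sorted block into the output. -/
def outputParams : List Instr :=
  [.add 18 .left 9 9, .add 19 .mul 3 5, .add 19 .left 10 10, .add 20 .left 0 0, .add 26 .sub 8 0,
    .add 21 .sub 8 26, .add 21 .left 9 9, .sub 26 .sub 8 0]

/-- Merge a block into the output. -/
def processBlock : Prog :=
  wth (block blockParams) (wth sortBlock (wth (block outputParams) mergeInto))

/-- The sorting program. -/
def sortProg : Prog := wth setup (forLoop 7 3 processBlock)

/-- The registers after `setup`. -/
structure MainRegs (r : Regs) (n e B i : ℕ) : Prop where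
  h0 : r 0 = n
  h2 : r 2 = 1
  h3 : r 3 = e
  h5 : r 5 = B
  h7 : r 7 = i
  h8 : r 8 = 0
  h9 : r 9 = 0
  h10 : r 10 = 2 * n
  hz : ∀ y, 11 ≤ y → r y = 0

/-- The power `2 ^ i` is advanced reversibly: it is subtracted from itself via `1 <<< i`, then `i`
is incremented and the new power added. It never exceeds `2 * n`. -/
theorem setup_exec {r : Regs} {n : ℕ} (hn : 2 ≤ n) (hw : 4 * n < 2 ^ w)
    (h0 : r 0 = n) (hz : ∀ y, 2 ≤ y → r y = 0) :
    ∃ r', (∀ k : Keys d, Exec w kb setup r k r' k 0 (5 * n.size + 7)) ∧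
      MainRegs r' n n.size (n / n.size + 1) 0 := by
  set e := n.size with he
  have hen : n < 2 ^ e := Nat.size_le.1 le_rfl
  have hpow : ∀ i ≤ e, 2 ^ i ≤ 2 * n := fun i hi => by
    rcases i with _ | i
    · simp; omega
    · have := Nat.lt_size.1 (Nat.lt_of_succ_le hi)
      rw [pow_succ]; omega
  have hek : e ≤ n := Nat.size_le.2 Nat.lt_two_pow_self
  have he1 : 1 ≤ e := by
    rcases Nat.eq_zero_or_pos e with h | h
    · rw [h] at hen; omega
    · exact h
  set r₀ := update r 2 1 with hr₀
  have h1 : ∀ k : Keys d, Exec w kb (.instr (.addC 2 1)) r k r₀ k 1 1 := fun k =>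
    (Exec.addC (by rw [hz 2 le_rfl]; omega)).congr (by rw [hz 2 le_rfl]) rfl
  have h4 : r₀ 4 = 0 := by simp [hr₀, hz]
  have h2 : ∀ k : Keys d, Exec w kb (.instr (.addC 4 1)) r₀ k (update r₀ 4 1) k 1 1 := fun k =>
    (Exec.addC (by rw [h4]; omega)).congr (by rw [h4]) rfl
  have h3 : ∀ k : Keys d, Exec w kb (.loop (.eqC 3 0) .skip
      (block [.sub 4 .shl 2 3, .addC 3 1, .add 4 .shl 2 3]) (.lt 0 4)) (update r₀ 4 1) k
      (update (update r₀ 3 e) 4 (2 ^ e)) k 0 (e * 5 + 2) := fun k => by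
    obtain ⟨r', k', hE, rfl, rfl⟩ := Exec.loop (w := w) (kb := kb) (t := .eqC 3 0) (u := .lt 0 4)
      (Q := block [.sub 4 .shl 2 3, .addC 3 1, .add 4 .shl 2 3]) (r := update r₀ 4 1) (k := k) e
      (fun i r' k' => r' = update (update r₀ 3 i) 4 (2 ^ i) ∧ k' = k) (fun _ => 0) 3
      (by rintro i r' k' ⟨rfl, rfl⟩; simp [Test.holds, State.mk'])
      (by
        rintro i r' k' hi ⟨rfl, rfl⟩
        -- `n < 2 ^ i` means `n.size ≤ i`; with `i ≤ e` this leaves only `i = e`.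
        simp only [Test.holds, State.mk', hr₀]
        simp [h0, ← Nat.size_le]
        omega)
      (by
        rintro i hi r' k' ⟨rfl, rfl⟩
        have hp := hpow (i + 1) hi
        have hs : RegSteps w [.sub 4 .shl 2 3, .addC 3 1, .add 4 .shl 2 3]
            (update (update r₀ 3 i) 4 (2 ^ i)) _ :=
          RegSteps.sub 0 (by simp [hr₀, BinOp.eval, Nat.shiftLeft_eq]) (by decide) (by decide) <|
          RegSteps.addC (i + 1) (by simp) (by omega) <|
          RegSteps.add (2 ^ (i + 1)) (by simp [hr₀, BinOp.eval, Nat.shiftLeft_eq]) (by omega)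
            (by decide) (by decide) <|
          RegSteps.nil _
        refine ⟨_, _, Exec.block hs.1 k', ?_, rfl⟩
        rw [hs.2]
        funext y
        simp only [Function.update_apply]
        split_ifs <;> rfl)
      ⟨by
        funext y
        by_cases hy : y = 3
        · subst hy; simp [hr₀, hz]
        · simp [Function.update_apply, hy], rfl⟩
    exact hE.mono (Nat.zero_le _) le_rfl
  have hdiv : n / e ≤ n := Nat.div_le_self _ _
  obtain ⟨r', ⟨hok, hr'⟩, hM⟩ : ∃ r', RegSteps w [.add 5 .div 0 3, .addC 5 1, .add 10 .add 0 0]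
      (update (update r₀ 3 e) 4 (2 ^ e)) r' ∧ MainRegs r' n e (n / e + 1) 0 := by
    refine ⟨_, RegSteps.add (n / e) (by simp [hr₀, BinOp.eval, h0, hz]) (by omega)
        (by decide) (by decide) <|
      RegSteps.addC (n / e + 1) (by simp) (by omega) <|
      RegSteps.add (2 * n) (by simp [hr₀, BinOp.eval, h0, hz]; omega) (by omega)
        (by decide) (by decide) <|
      RegSteps.nil _, ?_⟩
    constructor
    case hz =>
      intro y hy
      have : y ≠ 10 ∧ y ≠ 5 ∧ y ≠ 4 ∧ y ≠ 3 ∧ y ≠ 2 := by omega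
      simp [hr₀, this, hz y (by omega)]
    all_goals simp [hr₀, h0, hz]
  refine ⟨r', fun k => ?_, hM⟩
  have h4 := Exec.block (kb := kb) hok k
  rw [hr'] at h4
  refine ((h1 k).seq ((h2 k).seq ((h3 k).seq h4))).mono (Nat.zero_le _) ?_
  simp
  omega

theorem blockParams_steps {r : Regs} {n e B i : ℕ} (h : MainRegs r n e B i)
    (hB : B < 2 ^ w) (hn : n < 2 ^ w) (hi : i * B < 2 ^ w) :
    ∃ r', RegSteps w blockParams r r' ∧ r' 0 = n ∧
      SortRegs r' e B (i * B) (min B (n - i * B)) (2 * n) := by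
  obtain ⟨h0, h2, h3, h5, h7, h8, h9, h10, hz⟩ := h
  have hz26 := hz 26 (by omega)
  have hz27 := hz 27 (by omega)
  refine ⟨_, RegSteps.add (i * B) (by simp [BinOp.eval, *]) (by omega) (by decide) (by decide) <|
    RegSteps.add (n - i * B) (by simp [BinOp.eval, *]) (by omega) (by decide) (by decide) <|
    RegSteps.add (B - (n - i * B)) (by simp [BinOp.eval, *]) (by omega) (by decide) (by decide) <|
    RegSteps.add (min B (n - i * B)) (by simp [BinOp.eval, *]; omega) (by omega)
      (by decide) (by decide) <|
    RegSteps.sub 0 (by simp [BinOp.eval, *]) (by decide) (by decide) <|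
    RegSteps.sub 0 (by simp [BinOp.eval, *]) (by decide) (by decide) <|
    RegSteps.nil _, by simp [h0], ?_⟩
  constructor
  case hz =>
    intro y hy
    have : y ≠ 8 ∧ y ≠ 9 := by omega
    by_cases h26 : y = 26
    · subst h26; simp
    · by_cases h27 : y = 27
      · subst h27; simp
      · simp [this, h26, h27, hz y hy]
  all_goals simp [*]

/-- As `B` is rounded up, the last blocks may start beyond `n` and be empty; `min off n` is the
number of keys already in the output. -/
theorem outputParams_steps {r : Regs} {n e B off len : ℕ} (h0 : r 0 = n)
    (h : SortRegs r e B off len (2 * n)) (hB : 2 * n + e * B < 2 ^ w) (hn : n + len < 2 ^ w)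
    (hoff : off < 2 ^ w) :
    ∃ r', RegSteps w outputParams r r' ∧
      MergeRegs r' (2 * n + e * B) n len (min off n + len) 0 0 := by
  obtain ⟨h2, h3, h5, h8, h9, h10, hz⟩ := h
  have hz18 := hz 18 (by omega)
  have hz19 := hz 19 (by omega)
  have hz20 := hz 20 (by omega)
  have hz21 := hz 21 (by omega)
  have hz26 := hz 26 (by omega)
  refine ⟨_, RegSteps.add len (by simp [BinOp.eval, *]) (by omega) (by decide) (by decide) <|
    RegSteps.add (e * B) (by simp [BinOp.eval, *]) (by omega) (by decide) (by decide) <|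
    RegSteps.add (2 * n + e * B) (by simp [BinOp.eval, h10]; omega) (by omega)
      (by decide) (by decide) <|
    RegSteps.add n (by simp [BinOp.eval, *]) (by omega) (by decide) (by decide) <|
    RegSteps.add (off - n) (by simp [BinOp.eval, *]) (by omega) (by decide) (by decide) <|
    RegSteps.add (min off n) (by simp [BinOp.eval, *]; omega) (by omega) (by decide) (by decide) <|
    RegSteps.add (min off n + len) (by simp [BinOp.eval, h9]) (by omega) (by decide) (by decide) <|
    RegSteps.sub 0 (by simp [BinOp.eval, *]) (by decide) (by decide) <|
    RegSteps.nil _, ?_⟩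
  constructor <;> simp [h2, hz]

/-! ### Sorting a block, merging it into the output, and unsorting it -/

/-- The keys when the first `t` elements of the input `L` have been sorted. -/
def outKeys (L : List (Fin (2 ^ d))) (t : ℕ) : Keys d := fun y => (L ++ srt (L.take t))[y]?

theorem outKeys_of_lt {L : List (Fin (2 ^ d))} (t : ℕ) {y : ℕ} (hy : y < L.length) :
    outKeys L t y = L[y]? := List.getElem?_append_left hy

theorem outKeys_add (L : List (Fin (2 ^ d))) (t y : ℕ) :
    outKeys L t (L.length + y) = (srt (L.take t))[y]? := by
  rw [outKeys, List.getElem?_append_right (Nat.le_add_right _ _), Nat.add_sub_cancel_left]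

theorem overlay_outKeys (L : List (Fin (2 ^ d))) (t B e : ℕ) (X : List (Fin (2 ^ d)))
    (hX : X = (L.drop t).take B) :
    overlay (sortKeys (outKeys L t) (2 * L.length) B X e 0) L.length
      (srt (srt (L.take t) ++ srt X)) =
      sortKeys (outKeys L (t + B)) (2 * L.length) B X e 0 := by
  have hs : srt (srt (L.take t) ++ srt X) = srt (L.take (t + B)) := by
    rw [List.take_add, ← hX]
    exact srt_congr ((srt_perm _).append (srt_perm _))
  rw [hs]
  funext y
  simp only [overlay, length_srt, List.length_take]
  split_ifs with hy
  · obtain ⟨p, rfl⟩ := Nat.exists_eq_add_of_le hy.1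
    rw [sortKeys, if_pos (by omega), outKeys_add, Nat.add_sub_cancel_left]
  · by_cases hy2 : y < 2 * L.length
    · rw [sortKeys, sortKeys, if_pos hy2, if_pos hy2]
      by_cases hyn : y < L.length
      · rw [outKeys_of_lt _ hyn, outKeys_of_lt _ hyn]
      · obtain ⟨p, rfl⟩ := Nat.exists_eq_add_of_le (not_lt.1 hyn)
        rw [outKeys_add, outKeys_add, List.getElem?_eq_none, List.getElem?_eq_none] <;>
          simp <;> omega
    · rw [sortKeys, sortKeys, if_neg hy2, if_neg hy2]

/-- The upper bound pays twice for the sorting, once for each direction, and once for the merge; the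
lower bound is the length of the merged output. -/
theorem processBlock_exec (hw : 2 ≤ w) {r : Regs} (hr : Fits w r) {e B i : ℕ}
    {L : List (Fin (2 ^ d))} (h : MainRegs r L.length e B i) (he : 0 < e) (hB : 0 < B)
    (hL : L.length < 2 ^ e) (hi : i * B ≤ 2 * L.length)
    (hkb : 2 * L.length + (e + 1) * B ≤ kb) (hekb : 2 ^ e ≤ kb) (hkw : kb < 2 ^ w) :
    Exec w kb processBlock r (outKeys L (i * B)) r (outKeys L ((i + 1) * B))
      (min ((i + 1) * B) L.length) (440 * (e * B) + 30 * L.length + 32) := by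
  have heB : (e + 1) * B = e * B + B := Nat.succ_mul _ _
  obtain ⟨r₁, ⟨hok, hr₁⟩, h0, hS⟩ := blockParams_steps (w := w) h (by omega) (by omega) (by omega)
  have hf := hok.fits hr
  rw [Nat.succ_mul]
  refine (Exec.wthBlock_self (hi := 440 * (e * B) + 30 * L.length + 20) (by omega) hr hok ?_).mono
    le_rfl (by simp [blockParams])
  rw [hr₁] at hf ⊢
  generalize hoff : i * B = off at *
  set X := (L.drop off).take B with hX
  have hXl : X.length = min B (L.length - off) := by simp [hX]
  rw [← hXl] at hS
  have hsort : ∀ t, Exec w kb sortBlock r₁ (outKeys L t) r₁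
      (sortKeys (outKeys L t) (2 * L.length) B X e 0) 0 (220 * (e * B)) := fun t => by
    refine sortBlock_exec hw hf hS he hB (by omega) (fun p hp => ?_) (fun y hy => ?_) (by omega)
      hkb hekb hkw
    · rw [outKeys_of_lt _ (by omega), hX, List.getElem?_take_of_lt (by omega), List.getElem?_drop]
    · rw [outKeys, List.getElem?_eq_none]
      simp
      omega
  -- The block is sorted next to the old output and unsorted next to the new one; `hsort` holds for
  -- every state of the output.
  refine (Exec.wth (hi := 30 * L.length + 20) (by omega) rfl hf (hsort off) ?_
    (hsort (off + B))).mono le_rfl (by omega)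
  obtain ⟨r₂, ⟨hok₂, hr₂⟩, hM⟩ := outputParams_steps (w := w) h0 hS (by omega) (by omega) (by omega)
  have hf₂ := hok₂.fits hf
  refine (Exec.wthBlock_self (lo := min off L.length + X.length)
    (hi := 30 * (min off L.length + X.length) + 4) (by omega) hf hok₂ ?_).mono
    (by omega) (by simp [outputParams]; omega)
  rw [hr₂] at hf₂ ⊢
  rw [← length_srt X] at hM ⊢
  rw [← overlay_outKeys L off B e X hX]
  have hXl' := length_srt X
  refine mergeInto_exec hw hf₂ hM (by simp) (srt_pairwise _) (srt_pairwise _)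
    (fun p hp => ?_) (fun p hp => ?_) (fun p hp q hq => ?_) (by omega) (by omega) hkw
  -- Since `2 ^ e` exceeds the length of the block, level `e` is a single sorted run.
  · have := runCells_add X 0 (show p < 2 ^ e by omega)
    rw [sortKeys_at _ _ _ _ _ _ (by omega), if_pos le_rfl]
    rw [Nat.zero_mul, Nat.zero_add, List.drop_zero, List.take_of_length_le (by omega)] at this
    exact this
  · rw [sortKeys, if_pos (by omega), outKeys_add]
  · omega

/-! ### Resources of the whole program -/

/-- The first `e` multiples of `B`, cut off at `n`, add up to at least `n * e / 2`. -/
theorem le_two_mul_sum_min {n e B : ℕ} (he : 0 < e) (hB : n ≤ e * B) :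
    n * (e + 1) ≤ 2 * ∑ i ∈ Finset.range e, min ((i + 1) * B) n := by
  -- By concavity, the cut-off multiples lie above the chord from `0` at `0` to `n` at `e`.
  have h1 : ∀ i ∈ Finset.range e, n * (i + 1) ≤ e * min ((i + 1) * B) n := fun i hi => by
    have hi := Finset.mem_range.1 hi
    rcases le_total ((i + 1) * B) n with h | h
    · rw [min_eq_left h]
      calc n * (i + 1) ≤ e * B * (i + 1) := Nat.mul_le_mul_right _ hB
        _ = e * ((i + 1) * B) := by ring
    · rw [min_eq_right h, Nat.mul_comm]
      exact Nat.mul_le_mul_right _ hi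
  have h2 := Finset.sum_le_sum h1
  rw [← Finset.mul_sum, ← Finset.mul_sum] at h2
  have h3 : (∑ i ∈ Finset.range e, (i + 1)) * 2 = e * (e + 1) := by
    have := Finset.sum_range_id_mul_two (e + 1)
    rw [Finset.sum_range_succ'] at this
    simp only [Nat.add_sub_cancel, Nat.add_zero] at this
    rw [this]
    ring
  refine Nat.le_of_mul_le_mul_left ?_ he
  calc e * (n * (e + 1)) = n * (∑ i ∈ Finset.range e, (i + 1)) * 2 := by rw [mul_assoc, h3]; ring
    _ ≤ e * (∑ i ∈ Finset.range e, min ((i + 1) * B) n) * 2 := Nat.mul_le_mul_right _ h2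
    _ = _ := by ring

/-- Input and output take `2 * n` cells and the levels `(e + 1) * B ≤ 2 * n + e + 1`, so `8 * n`
bounds all addresses; it also bounds `2 ^ e ≤ 2 * n`. -/
theorem sortProg_exec {L : List (Fin (2 ^ d))} {r : Regs} (hn : 2 ≤ L.length)
    (hw : 8 * L.length < 2 ^ w) (hr : Fits w r) (h0 : r 0 = L.length)
    (hz : ∀ y, 2 ≤ y → r y = 0) :
    ∃ lo, L.length * (L.length.size + 1) ≤ 2 * lo ∧
      Exec w (8 * L.length) sortProg r (fun y => L[y]?) r (fun y => (L ++ srt L)[y]?) lo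
        (1000 * (L.length.size * L.length)) := by
  set n := L.length with hnL
  set e := n.size with he
  have hen : n < 2 ^ e := Nat.size_le.1 le_rfl
  have hw2 : 2 ≤ w := by
    by_contra h
    have : 2 ^ w ≤ 2 ^ 1 := Nat.pow_le_pow_right (by norm_num) (by omega)
    omega
  have he2 : 2 ≤ e := Nat.lt_size.2 (by simpa using hn)
  have hpow : 2 ^ e ≤ 2 * n := by
    have := Nat.lt_size.1 (show e - 1 < n.size by omega)
    rw [show e = e - 1 + 1 by omega, pow_succ]; omega
  have hek : e ≤ n := Nat.size_le.2 Nat.lt_two_pow_self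
  obtain ⟨r₁, hset, hM⟩ := setup_exec (d := d) (w := w) (kb := 8 * n) hn
    (by omega) h0 hz
  rw [← he] at hset hM
  set B := n / e + 1 with hB
  have heB : n ≤ e * B := by
    have := Nat.lt_mul_div_succ n (show 0 < e by omega)
    exact this.le
  have heB' : e * B ≤ n + e := by
    rw [hB, Nat.mul_add, Nat.mul_one]
    exact Nat.add_le_add_right (Nat.mul_div_le _ _) _
  have hBn : B ≤ n + 1 := Nat.succ_le_succ (Nat.div_le_self _ _)
  have hrev : setup.isRev = true := rfl
  have hf₁ : Fits w r₁ := by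
    obtain ⟨c, hc, -⟩ := hset (fun y => L[y]?)
    have hs : (State.mk' r (fun y => L[y]?)).Fits w := hr
    exact (Prog.Run.inv (by omega) hrev hs hc).1
  obtain ⟨r', k', hE, rfl, rfl⟩ := Exec.forLoop (w := w) (kb := 8 * n) (x := 7) (y := 3)
    (Q := processBlock) (r := r₁) (k := fun y => L[y]?) (by decide) e (by omega)
    (fun i r' k' => r' = r₁ ∧ k' = outKeys L (i * B))
    (fun i => min ((i + 1) * B) n) (440 * (e * B) + 30 * n + 32)
    (by rintro i r' k' ⟨rfl, -⟩; exact ⟨hM.h7, hM.h3⟩)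
    (by
      rintro i hi r' k' ⟨rfl, rfl⟩
      refine ⟨r', _, processBlock_exec hw2 (hf₁.update (by omega)) ?_ (by omega) (Nat.succ_pos _) hen ?_ ?_
        (by omega) hw, rfl, rfl⟩
      · obtain ⟨g0, g2, g3, g5, g7, g8, g9, g10, gz⟩ := hM
        constructor
        case hz =>
          intro y hy
          have : y ≠ 7 := by omega
          simp [this, gz y hy]
        all_goals simp [*]
      · have : i * B ≤ e * B := Nat.mul_le_mul_right _ hi.le
        omega
      · have : (e + 1) * B = e * B + B := Nat.succ_mul _ _
        omega)
    ⟨rfl, by funext y; simp [outKeys]⟩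
  have hfin : outKeys L (e * B) = fun y => (L ++ srt L)[y]? := by
    funext y
    rw [outKeys, List.take_of_length_le (by omega)]
  rw [hfin] at hE
  refine ⟨∑ i ∈ Finset.range e, (min ((i + 1) * B) n + 1), ?_, ?_⟩
  · refine (le_two_mul_sum_min (by omega) heB).trans (Nat.mul_le_mul_left _ ?_)
    exact Finset.sum_le_sum fun i _ => Nat.le_succ _
  · refine (Exec.wth (by omega) hrev hr (hset _) hE (hset _)).mono le_rfl ?_
    -- `e * B ≤ n + e ≤ 2 * n` gives at most `910 * n`; the rest is slack.
    have h1 : e * (440 * (e * B) + 30 * n + 32 + 3) ≤ e * (930 * n + 35) :=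
      Nat.mul_le_mul_left _ (by omega)
    have h2 : e * (930 * n + 35) = 930 * (e * n) + 35 * e := by ring
    have h3 : e * 2 ≤ e * n := Nat.mul_le_mul_left _ hn
    omega

end EnergyRAM

/-! ### Final constants -/

open EnergyRAM in
theorem mainTheorem2 :
    ∃ (P : Prog) (a : ℕ) (c₁ c₂ c₃ : ℝ), 0 < c₁ ∧ 0 < c₂ ∧ 0 < c₃ ∧
      ∀ K : ℕ, ∃ c₄ : ℝ, 0 < c₄ ∧
        ∀ n d w : ℕ, 2 ≤ n → 1 ≤ d → d ≤ w → a * (n * d) < 2 ^ w → w ≤ K * (n * d) →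
          ∀ L : List (Fin (2 ^ d)), L.length = n →
            ∃ (S : List (Fin (2 ^ d))) (c : Cost),
              S.Perm L ∧ S.Pairwise (· ≤ ·) ∧
              P.Run w (State.ofKeys n d L) (State.ofKeys n d (L ++ S)) c ∧
              c₁ * (n * Real.logb 2 n) ≤ c.time ∧ (c.time : ℝ) ≤ c₂ * (n * Real.logb 2 n) ∧
              c₃ * (n * d) ≤ auxSpace P n d w c ∧ (auxSpace P n d w c : ℝ) ≤ c₄ * (n * d) ∧
              c.energy = 0 := by
  refine ⟨sortProg, 8, 1 / 2, 2000, 1, by norm_num, by norm_num, by norm_num, fun K =>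
    ⟨8 + sortProg.regs.card * K, by positivity, fun n d w hn hd hdw haw hwK L hL => ?_⟩⟩
  subst hL
  set n := L.length with hnL
  have hnd : n ≤ n * d := Nat.le_mul_of_pos_right _ hd
  have hdw' : d < 2 ^ w := hdw.trans_lt Nat.lt_two_pow_self
  obtain ⟨lo, hlo, c, hrun, hen, hbits, hkeys, hlo', hhi⟩ := sortProg_exec (w := w) (L := L)
    (r := (State.ofKeys n d L).reg) hn (by omega)
    (fun x => by simp only [State.ofKeys]; split_ifs <;> omega) rfl
    (fun y hy => by
      have : y ≠ 0 ∧ y ≠ 1 := by omega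
      simp [State.ofKeys, this])
  have hn0 : (0 : ℝ) < n := by exact_mod_cast (show 0 < n by omega)
  have he2 : 2 ≤ n.size := Nat.lt_size.2 (by simpa using hn)
  have hlog_le : Real.logb 2 n ≤ n.size := by
    rw [Real.logb_le_iff_le_rpow (by norm_num) hn0, Real.rpow_natCast]
    exact_mod_cast (Nat.size_le.1 (le_refl n.size)).le
  have hle_log : (n.size : ℝ) - 1 ≤ Real.logb 2 n := by
    rw [Real.le_logb_iff_rpow_le (by norm_num) hn0]
    have := Nat.lt_size.1 (show n.size - 1 < n.size by omega)
    rw [show (n.size : ℝ) - 1 = ((n.size - 1 : ℕ) : ℝ) by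
      rw [Nat.cast_sub (by omega), Nat.cast_one], Real.rpow_natCast]
    exact_mod_cast this
  have he2' : (2 : ℝ) ≤ n.size := by exact_mod_cast he2
  -- The last output cell `2 * n - 1` is empty at the start and occupied at the end.
  have hk : 2 * n ≤ c.keys := by
    by_contra hlt
    have := hrun.key (a := 2 * n - 1) (by omega)
    simp only [State.mk'] at this
    rw [List.getElem?_eq_none (show L.length ≤ 2 * n - 1 by omega),
      List.getElem?_eq_none_iff] at this
    simp at this
    omega
  refine ⟨srt L, c, srt_perm L, srt_pairwise L, hrun, ?_, ?_, ?_, ?_, hen⟩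
  · have h1 : (n : ℝ) * (n.size + 1) ≤ 2 * c.time := by
      exact_mod_cast hlo.trans (Nat.mul_le_mul_left _ hlo')
    have h2 : (n : ℝ) * Real.logb 2 n ≤ n * (n.size + 1) :=
      mul_le_mul_of_nonneg_left (by linarith) hn0.le
    linarith
  · have h1 : (c.time : ℝ) ≤ 1000 * (n.size * n) := by exact_mod_cast hhi
    -- From `n.size ≥ 2` it follows that `n.size ≤ 2 * (n.size - 1)`, whence the factor `2` in
    -- `2000`.
    have h2 : (n : ℝ) * n.size ≤ n * (2 * Real.logb 2 n) :=
      mul_le_mul_of_nonneg_left (by linarith) hn0.le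
    linarith
  · have : n * d ≤ auxSpace sortProg n d w c := by
      have h1 : n * d ≤ (c.keys - n) * d := Nat.mul_le_mul_right _ (by omega)
      simp only [auxSpace]
      omega
    rw [one_mul]
    exact_mod_cast this
  · have : auxSpace sortProg n d w c ≤ (8 + sortProg.regs.card * K) * (n * d) := by
      have h1 : (c.keys - n) * d ≤ 8 * n * d := Nat.mul_le_mul_right _ (by omega)
      have h2 : sortProg.regs.card * w ≤ sortProg.regs.card * (K * (n * d)) :=
        Nat.mul_le_mul_left _ hwK
      calc auxSpace sortProg n d w c ≤ 0 + 8 * n * d + sortProg.regs.card * (K * (n * d)) := by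
            simp only [auxSpace, hbits]; omega
        _ = _ := by ring
    exact_mod_cast this
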